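/- **Setting.** Let $p\cdot x=-p^0x^0+\mathbf p\cdot\mathbf x$ on $\mathbb R^{1,3}$, and let $\lambda:SL(2,\mathbb C)\to SO^+(1,3)$ be the universal covering, $\lambda(A):X\mapsto AXA^\dagger$ on Hermitian $2\times2$ matrices $X\cong\mathbb R^{1,3}$. Fix a mass $m\ge 0$, the mass shell $\{p: p^2=-m^2,\ p^0>0\}$ with the measure $d^3p$, the standard momentum $k=(m,0,0,0)$ if $m>0$ and $k=(1,0,0,1)$ if $m=0$, the little group $\mathcal W=\{W\in SL(2,\mathbb C):\lambda(W)k=k\}$, a measurable choice of $L(p)\in SL(2,\mathbb C)$ with $\lambda(L(p))k=p$, and put $W(\Lambda,p)=L(\lambda(\Lambda)p)^{-1}\Lambda L(p)\in\mathcal W$. Let $n$ run over a finite set of particle species, and for each $n$ let $D^{(j_n)}$ be a continuous finite-dimensional unitary representation of $\mathcal W$, with spin index $\sigma$. The state representation $U_0$ of $\mathbb R^{1,3}\rtimes SL(2,\mathbb C)$ on single-particle states is $$U_0(\Lambda,a)\Psi_{p,\sigma,n}=e^{-i(\lambda(\Lambda)p)\cdot a}\sqrt{\tfrac{(\lambda(\Lambda)p)^0}{p^0}}\sum_{\sigma'}D^{(j_n)}_{\sigma'\sigma}(W(\Lambda,p))\,\Psi_{\lambda(\Lambda)p,\sigma',n},$$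 extended linearly to superpositions $\sum_{\sigma,n}\int d^3p\,\varphi(p,\sigma,n)\Psi_{p,\sigma,n}$ and by tensor powers to the bosonic or fermionic Fock space. Let $a(p,\sigma,n)$, $a^\dagger(p,\sigma,n)$ be the annihilation and creation operators. Let $D$ be a finite-dimensional complex representation of $SL(2,\mathbb C)$ with matrix entries $D_{l\bar l}$, let $u_l(p,\sigma,n)$, $v_l(p,\sigma,n)$ be locally integrable functions of $p$ on the mass shell, and let $$\psi^+_l(x)=(2\pi)^{-3/2}\sum_{\sigma,n}\int d^3p\,u_l(p,\sigma,n)e^{ip\cdot x}a(p,\sigma,n),\qquad \psi^-_l(x)=(2\pi)^{-3/2}\sum_{\sigma,n}\int d^3p\,v_l(p,\sigma,n)e^{-ip\cdot x}a^\dagger(p,\sigma,n).$$ These act on finite-particle vectors with bounded measurable compactly supported (anti)symmetric wave functions; $\psi^-_l(x)$ and $U_0$ are understood on sequences of $N$-particle wave functions that need not be square integrable, and identities hold almost everywhere in the momenta. **Theorem.** The Lorentz transformation axiom $$U_0(\Lambda,a)^{-1}\,\psi^\pm_l(\lambda(\Lambda)x+a)\,U_0(\Lambda,a)=\sum_{\bar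 l}D_{l\bar l}(\Lambda)\,\psi^\pm_{\bar l}(x)\qquad\text{for all }\Lambda\in SL(2,\mathbb C),\ a,x\in\mathbb R^{1,3},\ l,$$ for both signs, holds if and only if the following two conditions hold: 1. the linear map $\Psi_{p,\sigma,n}\mapsto\sum_l u_l(p,\sigma,n)e_l$, that is $\varphi\mapsto\big(\sum_{\sigma,n}\int d^3p\,\varphi(p,\sigma,n)u_l(p,\sigma,n)\big)_l$ on bounded measurable compactly supported wave functions $\varphi$, is a homomorphism of representations of $SL(2,\mathbb C)$ from $U_0|_{SL(2,\mathbb C)}$ to $D$; 2. the linear map $\Psi^*_{p,\sigma,n}\mapsto\sum_l v_l(p,\sigma,n)e_l$ on the dual basis, that is the map taking the functional $\varphi\mapsto\sum_{\sigma,n}\int d^3p\,\chi(p,\sigma,n)\varphi(p,\sigma,n)$ to $\big(\sum_{\sigma,n}\int d^3p\,\chi(p,\sigma,n)v_l(p,\sigma,n)\big)_l$ for bounded measurable compactly supported $\chi$, is a homomorphism of representations of $SL(2,\mathbb C)$ from the dual of $U_0|_{SL(2,\mathbb C)}$ to $D$ (in particular, the dual action of $SL(2,\mathbb C)$ preserves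 the space of these functionals). -/

import Mathlib

open MeasureTheory
open scoped Matrix

noncomputable section

namespace QField

/-! ### Minkowski space and the covering of the Lorentz group -/

/-- The universal cover `SL(2,ℂ)` of the restricted Lorentz group. -/
abbrev SL2C : Type := Matrix.SpecialLinearGroup (Fin 2) ℂ

/-- Space-time (and four-momentum space) `ℝ^{1,3}`, coordinate `0` being time (energy). -/
abbrev R13 : Type := Fin 4 → ℝ

/-- The Minkowski product of signature `(-,+,+,+)`. -/
def mink (x y : R13) : ℝ := -(x 0 * y 0) + x 1 * y 1 + x 2 * y 2 + x 3 * y 3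

/-- The identification of `ℝ^{1,3}` with the Hermitian `2 × 2` matrices. -/
def herm (x : R13) : Matrix (Fin 2) (Fin 2) ℂ :=
  !![((x 0 + x 3 : ℝ) : ℂ), (x 1 : ℂ) - (x 2 : ℂ) * Complex.I;
     (x 1 : ℂ) + (x 2 : ℂ) * Complex.I, ((x 0 - x 3 : ℝ) : ℂ)]

/-- The inverse of `herm` on Hermitian matrices. -/
def unherm (X : Matrix (Fin 2) (Fin 2) ℂ) : R13 :=
  ![((X 0 0).re + (X 1 1).re) / 2, (X 1 0).re, (X 1 0).im, ((X 0 0).re - (X 1 1).re) / 2]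

lemma unherm_herm (x : R13) : unherm (herm x) = x := by
  funext i; fin_cases i <;> simp [unherm, herm]

lemma herm_unherm {X : Matrix (Fin 2) (Fin 2) ℂ} (hX : Xᴴ = X) : herm (unherm X) = X := by
  have h00 := congr_fun (congr_fun hX 0) 0
  have h11 := congr_fun (congr_fun hX 1) 1
  have h01 := congr_fun (congr_fun hX 0) 1
  simp only [Matrix.conjTranspose_apply, Complex.ext_iff, Complex.star_def, Complex.conj_re,
    Complex.conj_im] at h00 h11 h01
  ext i j
  fin_cases i <;> fin_cases j <;> apply Complex.ext <;> simp [unherm, herm] <;> linarith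

lemma herm_conjTranspose (x : R13) : (herm x)ᴴ = herm x := by
  ext i j
  fin_cases i <;> fin_cases j <;> simp [herm, sub_eq_add_neg]

lemma herm_add (x y : R13) : herm (x + y) = herm x + herm y := by
  ext i j
  fin_cases i <;> fin_cases j <;> simp [herm] <;> ring

lemma herm_smul (c : ℝ) (x : R13) : herm (c • x) = (c : ℂ) • herm x := by
  ext i j
  fin_cases i <;> fin_cases j <;> simp [herm] <;> ring

lemma det_herm (x : R13) : (herm x).det = ((-mink x x : ℝ) : ℂ) := by
  rw [Matrix.det_fin_two]
  apply Complex.ext <;> simp [herm, mink] <;> ring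

/-- The covering homomorphism `λ : SL(2,ℂ) → SO⁺(1,3)`, acting on `ℝ^{1,3}`: in terms of
Hermitian matrices, `λ(A)` is `X ↦ A X A†`. -/
def lorentz : Representation ℝ SL2C R13 where
  toFun A :=
    { toFun := fun x => unherm (A.1 * herm x * A.1ᴴ)
      map_add' := fun x y => by
        rw [herm_add, Matrix.mul_add, Matrix.add_mul]
        funext i; fin_cases i <;> simp [unherm] <;> ring
      map_smul' := fun c x => by
        rw [herm_smul, Matrix.mul_smul, Matrix.smul_mul]
        funext i; fin_cases i <;> simp [unherm] <;> ring }
  map_one' := LinearMap.ext fun x => by simp [unherm_herm]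
  map_mul' A B := by
    refine LinearMap.ext fun x => ?_
    have h : (B.1 * herm x * B.1ᴴ)ᴴ = B.1 * herm x * B.1ᴴ := by
      simp [Matrix.conjTranspose_mul, herm_conjTranspose, Matrix.mul_assoc]
    simp only [LinearMap.coe_mk, AddHom.coe_mk, Module.End.mul_apply,
      Matrix.SpecialLinearGroup.coe_mul, herm_unherm h]
    simp [Matrix.conjTranspose_mul, Matrix.mul_assoc]

lemma lorentz_apply (A : SL2C) (x : R13) : lorentz A x = unherm (A.1 * herm x * A.1ᴴ) := rfl

lemma herm_lorentz (A : SL2C) (x : R13) : herm (lorentz A x) = A.1 * herm x * A.1ᴴ := by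
  rw [lorentz_apply, herm_unherm]
  simp [Matrix.conjTranspose_mul, herm_conjTranspose, Matrix.mul_assoc]

lemma mink_lorentz_self (A : SL2C) (x : R13) : mink (lorentz A x) (lorentz A x) = mink x x := by
  have h := det_herm (lorentz A x)
  rw [herm_lorentz, Matrix.det_mul, Matrix.det_mul, Matrix.det_conjTranspose, A.2, det_herm] at h
  simp only [star_one, one_mul, mul_one] at h
  have := Complex.ofReal_injective h
  linarith

lemma mink_lorentz (A : SL2C) (x y : R13) : mink (lorentz A x) (lorentz A y) = mink x y := by
  have h := mink_lorentz_self A (x + y)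
  have hx := mink_lorentz_self A x
  have hy := mink_lorentz_self A y
  rw [map_add] at h
  simp only [mink, Pi.add_apply] at *
  linarith

lemma row_nonneg (s w c d a b e f : ℝ) (hs : 0 ≤ s) (hw : 0 ≤ w) (h : c ^ 2 + d ^ 2 ≤ s * w) :
    0 ≤ s * (a ^ 2 + b ^ 2) + w * (e ^ 2 + f ^ 2)
      + 2 * (c * (a * e + b * f) + d * (b * e - a * f)) := by
  rcases hs.eq_or_lt with rfl | hs'
  · have hc : c = 0 := by nlinarith [sq_nonneg c, sq_nonneg d]
    have hd : d = 0 := by nlinarith [sq_nonneg c, sq_nonneg d]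
    subst hc hd
    simp only [zero_mul, add_zero, mul_zero, zero_add]
    positivity
  · have key : 0 ≤ s * (s * (a ^ 2 + b ^ 2) + w * (e ^ 2 + f ^ 2)
        + 2 * (c * (a * e + b * f) + d * (b * e - a * f))) := by
      nlinarith [sq_nonneg (s * a + c * e - d * f), sq_nonneg (s * b + c * f + d * e),
        mul_nonneg (sub_nonneg.2 h) (add_nonneg (sq_nonneg e) (sq_nonneg f))]
    exact nonneg_of_mul_nonneg_right key hs'

lemma lorentz_zero_pos (A : SL2C) (x : R13) (h0 : 0 < x 0) (hx : mink x x ≤ 0) :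
    0 < (lorentz A x) 0 := by
  have hsq : x 1 ^ 2 + x 2 ^ 2 + x 3 ^ 2 ≤ x 0 ^ 2 := by simp only [mink] at hx; nlinarith
  have h3 : |x 3| ≤ x 0 := abs_le_of_sq_le_sq (by nlinarith [sq_nonneg (x 1), sq_nonneg (x 2)]) h0.le
  have h3' := abs_le.1 h3
  have hnn : 0 ≤ (lorentz A x) 0 := by
    have e : (lorentz A x) 0 =
        (((x 0 + x 3) * ((A.1 0 0).re ^ 2 + (A.1 0 0).im ^ 2)
          + (x 0 - x 3) * ((A.1 0 1).re ^ 2 + (A.1 0 1).im ^ 2)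
          + 2 * (x 1 * ((A.1 0 0).re * (A.1 0 1).re + (A.1 0 0).im * (A.1 0 1).im)
            + x 2 * ((A.1 0 0).im * (A.1 0 1).re - (A.1 0 0).re * (A.1 0 1).im)))
        + ((x 0 + x 3) * ((A.1 1 0).re ^ 2 + (A.1 1 0).im ^ 2)
          + (x 0 - x 3) * ((A.1 1 1).re ^ 2 + (A.1 1 1).im ^ 2)
          + 2 * (x 1 * ((A.1 1 0).re * (A.1 1 1).re + (A.1 1 0).im * (A.1 1 1).im)
            + x 2 * ((A.1 1 0).im * (A.1 1 1).re - (A.1 1 0).re * (A.1 1 1).im)))) / 2 := by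
      simp [lorentz_apply, unherm, herm, Matrix.mul_apply, Fin.sum_univ_two]
      ring
    rw [e]
    have h12 : x 1 ^ 2 + x 2 ^ 2 ≤ (x 0 + x 3) * (x 0 - x 3) := by nlinarith
    have r0 := row_nonneg _ _ (x 1) (x 2) (A.1 0 0).re (A.1 0 0).im (A.1 0 1).re (A.1 0 1).im
      (by linarith : 0 ≤ x 0 + x 3) (by linarith : 0 ≤ x 0 - x 3) h12
    have r1 := row_nonneg _ _ (x 1) (x 2) (A.1 1 0).re (A.1 1 0).im (A.1 1 1).re (A.1 1 1).im
      (by linarith : 0 ≤ x 0 + x 3) (by linarith : 0 ≤ x 0 - x 3) h12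
    linarith
  refine lt_of_le_of_ne hnn fun h => ?_
  have hm := mink_lorentz_self A x
  have hz : lorentz A x = 0 := by
    have hle : (lorentz A x) 1 ^ 2 + (lorentz A x) 2 ^ 2 + (lorentz A x) 3 ^ 2 ≤ 0 := by
      rw [← hm] at hx
      simp only [mink, ← h] at hx
      nlinarith
    have e1 : (lorentz A x) 1 = 0 := by
      nlinarith [sq_nonneg ((lorentz A x) 1), sq_nonneg ((lorentz A x) 2),
        sq_nonneg ((lorentz A x) 3)]
    have e2 : (lorentz A x) 2 = 0 := by
      nlinarith [sq_nonneg ((lorentz A x) 1), sq_nonneg ((lorentz A x) 2),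
        sq_nonneg ((lorentz A x) 3)]
    have e3 : (lorentz A x) 3 = 0 := by
      nlinarith [sq_nonneg ((lorentz A x) 1), sq_nonneg ((lorentz A x) 2),
        sq_nonneg ((lorentz A x) 3)]
    funext i
    fin_cases i
    · exact h.symm
    · exact e1
    · exact e2
    · exact e3
  have : x = 0 := by
    have h2 : lorentz A⁻¹ (lorentz A x) = x := by
      rw [← Module.End.mul_apply, ← map_mul]; simp
    rw [← h2, hz, map_zero]
  simp [this] at h0

/-! ### The covering of the Poincaré group -/

/-- `SL(2,ℂ)` acting on the translation group `ℝ^{1,3}` through `λ`. -/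
def lorentzMulAut : SL2C →* MulAut (Multiplicative R13) where
  toFun A := AddEquiv.toMultiplicative
    { toFun := lorentz A
      invFun := lorentz A⁻¹
      left_inv := fun x => by rw [← Module.End.mul_apply, ← map_mul]; simp
      right_inv := fun x => by rw [← Module.End.mul_apply, ← map_mul]; simp
      map_add' := map_add _ }
  map_one' := by ext1 x; simp
  map_mul' A B := by ext1 x; simp

/-- The universal cover `ℝ^{1,3} ⋊ SL(2,ℂ)` of the Poincaré group. -/
abbrev PoincareCover : Type := Multiplicative R13 ⋊[lorentzMulAut] SL2C

/-- The element `(Λ, a)` of `ℝ^{1,3} ⋊ SL(2,ℂ)`, acting on space-time by `x ↦ λ(Λ) x + a`. -/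
def poincare (Λ : SL2C) (a : R13) : PoincareCover := ⟨Multiplicative.ofAdd a, Λ⟩

/-! ### Mass shell, little group, standard transformations -/

/-- The mass shell `p² = -m²`, `p⁰ > 0` (massive case `m > 0`, massless case `m = 0`). -/
abbrev Shell (m : ℝ) : Type := {p : R13 // 0 < p 0 ∧ mink p p = -m ^ 2}

instance (m : ℝ) : MulAction SL2C (Shell m) where
  smul A p := ⟨lorentz A p.1,
    lorentz_zero_pos A p.1 p.2.1 (by rw [p.2.2]; nlinarith [sq_nonneg m]),
    by rw [mink_lorentz, p.2.2]⟩
  one_smul p := Subtype.ext (by change lorentz 1 p.1 = p.1; simp)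
  mul_smul A B p := Subtype.ext (by
    change lorentz (A * B) p.1 = lorentz A (lorentz B p.1); simp)

lemma coe_smul {m : ℝ} (A : SL2C) (p : Shell m) : ((A • p : Shell m) : R13) = lorentz A p.1 := rfl

lemma continuous_coord {m : ℝ} (i : Fin 4) : Continuous fun p : Shell m => p.1 i :=
  (continuous_apply i).comp continuous_subtype_val

lemma continuous_spatial (m : ℝ) :
    Continuous fun (p : Shell m) (i : Fin 3) => p.1 i.succ :=
  continuous_pi fun i => continuous_coord i.succ

/-- The measure `d³p` on the mass shell: Lebesgue measure in the coordinates
`𝐩 = (p¹, p², p³)`. -/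
def d3p (m : ℝ) : Measure (Shell m) :=
  Measure.comap (fun (p : Shell m) (i : Fin 3) => p.1 i.succ) volume

lemma measurableEmbedding_spatial (m : ℝ) :
    MeasurableEmbedding fun (p : Shell m) (i : Fin 3) => p.1 i.succ := by
  have hs : MeasurableSet {p : R13 | 0 < p 0 ∧ mink p p = -m ^ 2} := by
    refine MeasurableSet.inter (measurableSet_lt measurable_const (measurable_pi_apply 0)) ?_
    refine measurableSet_eq_fun ?_ measurable_const
    unfold mink
    fun_prop
  have : StandardBorelSpace (Shell m) := hs.standardBorel
  refine Measurable.measurableEmbedding (continuous_spatial m).measurable fun p q h => ?_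
  have h1 : p.1 1 = q.1 1 := congr_fun h 0
  have h2 : p.1 2 = q.1 2 := congr_fun h 1
  have h3 : p.1 3 = q.1 3 := congr_fun h 2
  have hp := p.2.2
  have hq := q.2.2
  have h0 : p.1 0 = q.1 0 := by
    simp only [mink, h1, h2, h3] at hp hq
    have : (p.1 0 - q.1 0) * (p.1 0 + q.1 0) = 0 := by linarith
    rcases mul_eq_zero.1 this with h | h
    · linarith
    · linarith [p.2.1, q.2.1]
  apply Subtype.ext
  funext i
  fin_cases i
  · exact h0
  · exact h1
  · exact h2
  · exact h3

instance (m : ℝ) : IsFiniteMeasureOnCompacts (d3p m) where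
  lt_top_of_isCompact K hK := by
    rw [d3p, (measurableEmbedding_spatial m).comap_apply]
    exact (hK.image (continuous_spatial m)).measure_lt_top

/-- The standard momentum: `(m,0,0,0)` for `m > 0`, `(1,0,0,1)` for `m = 0`. -/
def stdMomentum (m : ℝ) : R13 := if m = 0 then ![1, 0, 0, 1] else ![m, 0, 0, 0]

/-- The little group `𝒲 = {W ∈ SL(2,ℂ) | λ(W) k = k}` of the standard momentum `k`. -/
def littleGroup (m : ℝ) : Subgroup SL2C where
  carrier := {W | lorentz W (stdMomentum m) = stdMomentum m}
  one_mem' := by simp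
  mul_mem' {A B} hA hB := by
    simp only [Set.mem_ofPred_eq, map_mul, Module.End.mul_apply] at *
    rw [hB, hA]
  inv_mem' {A} hA := by
    simp only [Set.mem_ofPred_eq] at *
    conv_lhs => rw [← hA]
    rw [← Module.End.mul_apply, ← map_mul]; simp

/-- A measurable choice of standard transformations: `L(p) ∈ SL(2,ℂ)` with `λ(L(p)) k = p`. -/
structure StdTransf (m : ℝ) where
  /-- The transformation `L(p)`. -/
  L : Shell m → SL2C
  map_std : ∀ p, lorentz (L p) (stdMomentum m) = p.1
  measurable_entry : ∀ i j, Measurable fun p => (L p).1 i j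

/-- The Wigner rotation `W(Λ,p) = L(λ(Λ)p)⁻¹ Λ L(p)`. -/
def wigner {m : ℝ} (L : StdTransf m) (Λ : SL2C) (p : Shell m) : littleGroup m :=
  ⟨(L.L (Λ • p))⁻¹ * Λ * L.L p, by
    change lorentz ((L.L (Λ • p))⁻¹ * Λ * L.L p) (stdMomentum m) = stdMomentum m
    have h := L.map_std (Λ • p)
    rw [map_mul, map_mul, Module.End.mul_apply, Module.End.mul_apply, L.map_std, ← coe_smul,
      ← h, ← Module.End.mul_apply, ← map_mul]
    simp⟩

lemma wigner_mul {m : ℝ} (L : StdTransf m) (A B : SL2C) (p : Shell m) :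
    wigner L (A * B) p = wigner L A (B • p) * wigner L B p := by
  apply Subtype.ext
  simp only [wigner, Subgroup.coe_mul, mul_smul]
  group

lemma wigner_one {m : ℝ} (L : StdTransf m) (p : Shell m) : wigner L 1 p = 1 := by
  apply Subtype.ext
  simp [wigner]

/-! ### Single-particle states

The species are labelled by `n : κ`; a particle of species `n` has spin index `σ : B n` and its
little group representation is `Dj n`. The combined index `(n, σ)` is an element of `Σ n, B n`.
A one-particle wave function `φ` stands for the state `∑_{σ,n} ∫ d³p φ(p,σ,n) Ψ_{p,σ,n}`. -/

section Particles

variable {m : ℝ} {κ : Type*} [DecidableEq κ] {B : κ → Type*} [∀ n, Fintype (B n)]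
  [∀ n, DecidableEq (B n)]

/-- The matrix by which `U₀(Λ,a)` acts on wave functions at the final momentum `p`; with
`p₀ = λ(Λ)⁻¹ p` it is `e^{-i p·a} √(p₀⁰ / p⁰) D^{(j)}(W(Λ,p₀))`. -/
def kernel (L : StdTransf m) (Dj : ∀ n, littleGroup m →ₜ* Matrix.unitaryGroup (B n) ℂ)
    (g : PoincareCover) (p : Shell m) : Matrix (Σ n, B n) (Σ n, B n) ℂ :=
  (Complex.exp (-Complex.I * (mink p.1 (Multiplicative.toAdd g.left) : ℝ)) *
      (Real.sqrt ((g.right⁻¹ • p).1 0 / p.1 0) : ℝ)) •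
    Matrix.blockDiagonal' fun n =>
      (Dj n (wigner L g.right (g.right⁻¹ • p)) : Matrix (B n) (B n) ℂ)

lemma kernel_one (L : StdTransf m) (Dj : ∀ n, littleGroup m →ₜ* Matrix.unitaryGroup (B n) ℂ)
    (p : Shell m) : kernel L Dj 1 p = 1 := by
  have h : p.1 0 / p.1 0 = 1 := div_self p.2.1.ne'
  have h2 : (fun n => ((1 : Matrix.unitaryGroup (B n) ℂ) : Matrix (B n) (B n) ℂ)) = 1 := rfl
  simp only [kernel, SemidirectProduct.one_left, SemidirectProduct.one_right, inv_one, one_smul,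
    wigner_one, map_one, h, h2, Matrix.blockDiagonal'_one]
  simp [mink]

lemma kernel_mul [Fintype κ] (L : StdTransf m) (Dj : ∀ n, littleGroup m →ₜ* Matrix.unitaryGroup (B n) ℂ)
    (g h : PoincareCover) (p : Shell m) :
    kernel L Dj (g * h) p = kernel L Dj g p * kernel L Dj h (g.right⁻¹ • p) := by
  have e1 : (g.right⁻¹ • p).1 0 ≠ 0 := (g.right⁻¹ • p).2.1.ne'
  have hact : (g * h).right⁻¹ • p = h.right⁻¹ • g.right⁻¹ • p := by
    rw [SemidirectProduct.mul_right, mul_inv_rev, mul_smul]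
  have hw : wigner L (g * h).right ((g * h).right⁻¹ • p)
      = wigner L g.right (g.right⁻¹ • p) * wigner L h.right (h.right⁻¹ • g.right⁻¹ • p) := by
    rw [hact, SemidirectProduct.mul_right, wigner_mul, smul_inv_smul]
  have hm : mink p.1 (Multiplicative.toAdd (g * h).left) =
      mink p.1 (Multiplicative.toAdd g.left)
        + mink (g.right⁻¹ • p).1 (Multiplicative.toAdd h.left) := by
    have e : Multiplicative.toAdd (g * h).left
        = Multiplicative.toAdd g.left + lorentz g.right (Multiplicative.toAdd h.left) := rfl
    have e2 : mink (g.right⁻¹ • p).1 (Multiplicative.toAdd h.left)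
        = mink p.1 (lorentz g.right (Multiplicative.toAdd h.left)) := by
      rw [← mink_lorentz g.right, ← coe_smul, smul_inv_smul]
    rw [e, e2]
    simp only [mink, Pi.add_apply]
    ring
  have hs : Real.sqrt (((g * h).right⁻¹ • p).1 0 / p.1 0)
      = Real.sqrt ((g.right⁻¹ • p).1 0 / p.1 0)
        * Real.sqrt ((h.right⁻¹ • g.right⁻¹ • p).1 0 / (g.right⁻¹ • p).1 0) := by
    rw [← Real.sqrt_mul (div_nonneg (g.right⁻¹ • p).2.1.le p.2.1.le), hact]
    congr 1
    field_simp
  have hb : (Matrix.blockDiagonal' fun n =>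
      (Dj n (wigner L (g * h).right ((g * h).right⁻¹ • p)) : Matrix (B n) (B n) ℂ))
      = (Matrix.blockDiagonal' fun n =>
          (Dj n (wigner L g.right (g.right⁻¹ • p)) : Matrix (B n) (B n) ℂ)) *
        Matrix.blockDiagonal' fun n =>
          (Dj n (wigner L h.right (h.right⁻¹ • g.right⁻¹ • p)) : Matrix (B n) (B n) ℂ) := by
    rw [← Matrix.blockDiagonal'_mul, hw]
    congr 1
    funext n
    rw [map_mul]
    rfl
  unfold kernel
  rw [hm, hs, hb, Matrix.smul_mul, Matrix.mul_smul]
  refine Eq.trans ?_ (smul_smul _ _ _).symm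
  refine congrArg₂ (fun (c : ℂ) (M : Matrix (Σ n, B n) (Σ n, B n) ℂ) => c • M) ?_ rfl
  rw [Complex.ofReal_add, mul_add, Complex.exp_add, Complex.ofReal_mul]
  ring

variable [Fintype κ]

/-- The state representation `U₀` of `ℝ^{1,3} ⋊ SL(2,ℂ)` on one-particle wave functions:
the linear extension of `U₀(Λ,a) Ψ_{p,σ,n} =
e^{-i(λ(Λ)p)·a} √((λ(Λ)p)⁰/p⁰) ∑_σ' D^{(j_n)}_{σ'σ}(W(Λ,p)) Ψ_{λ(Λ)p,σ',n}`. -/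
def U₀ (L : StdTransf m) (Dj : ∀ n, littleGroup m →ₜ* Matrix.unitaryGroup (B n) ℂ) :
    Representation ℂ PoincareCover (Shell m → (Σ n, B n) → ℂ) where
  toFun g :=
    { toFun := fun φ p => kernel L Dj g p *ᵥ φ (g.right⁻¹ • p)
      map_add' := fun φ ψ => by funext p; simp [Matrix.mulVec_add]
      map_smul' := fun c φ => by funext p; simp [Matrix.mulVec_smul] }
  map_one' := by ext1 φ; funext p; simp [kernel_one]
  map_mul' g h := by
    refine LinearMap.ext fun φ => ?_
    funext p
    simp only [LinearMap.coe_mk, AddHom.coe_mk, Module.End.mul_apply, kernel_mul,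
      Matrix.mulVec_mulVec, SemidirectProduct.mul_right, mul_inv_rev, mul_smul]

end Particles

/-! ### Wave packets -/

/-- Bounded measurable functions with compact support on the mass shell. -/
structure IsPacket {m : ℝ} (f : Shell m → ℂ) : Prop where
  measurable : Measurable f
  bounded : ∃ C : ℝ, ∀ p, ‖f p‖ ≤ C
  compact : HasCompactSupport f

lemma IsPacket.zero {m : ℝ} : IsPacket (fun _ : Shell m => (0 : ℂ)) :=
  ⟨measurable_const, ⟨0, by simp⟩, HasCompactSupport.zero⟩

lemma IsPacket.add {m : ℝ} {f g : Shell m → ℂ} (hf : IsPacket f) (hg : IsPacket g) :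
    IsPacket (fun p => f p + g p) := by
  obtain ⟨C, hC⟩ := hf.bounded
  obtain ⟨C', hC'⟩ := hg.bounded
  exact ⟨hf.measurable.add hg.measurable,
    ⟨C + C', fun p => (norm_add_le _ _).trans (add_le_add (hC p) (hC' p))⟩,
    hf.compact.add hg.compact⟩

lemma IsPacket.const_mul {m : ℝ} {f : Shell m → ℂ} (hf : IsPacket f) (c : ℂ) :
    IsPacket (fun p => c * f p) := by
  obtain ⟨C, hC⟩ := hf.bounded
  refine ⟨hf.measurable.const_mul c, ⟨‖c‖ * C, fun p => ?_⟩, hf.compact.mul_left⟩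
  rw [norm_mul]
  exact mul_le_mul_of_nonneg_left (hC p) (norm_nonneg c)

lemma IsPacket.sum {m : ℝ} {ι : Type*} (t : Finset ι) {f : ι → Shell m → ℂ}
    (hf : ∀ i, IsPacket (f i)) : IsPacket (fun p => ∑ i ∈ t, f i p) := by
  classical
  induction t using Finset.induction_on with
  | empty => simpa using IsPacket.zero
  | insert a t ha ih => simpa [Finset.sum_insert ha] using (hf a).add ih

lemma IsPacket.integrable_mul {m : ℝ} {φ f : Shell m → ℂ} (hφ : IsPacket φ)
    (hf : LocallyIntegrable f (d3p m)) : Integrable (fun p => φ p * f p) (d3p m) := by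
  obtain ⟨C, hC⟩ := hφ.bounded
  have h1 : IntegrableOn (fun p => φ p * f p) (tsupport φ) (d3p m) :=
    (hf.integrableOn_isCompact hφ.compact).bdd_mul hφ.measurable.aestronglyMeasurable
      (Filter.Eventually.of_forall hC)
  refine (integrableOn_iff_integrable_of_support_subset ?_).1 h1
  exact (Function.support_mul_subset_left _ _).trans (subset_tsupport _)

lemma IsPacket.locallyIntegrable {m : ℝ} {φ : Shell m → ℂ} (hφ : IsPacket φ) :
    LocallyIntegrable φ (d3p m) := by
  obtain ⟨C, hC⟩ := hφ.bounded
  have h1 : IntegrableOn φ (tsupport φ) (d3p m) :=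
    IntegrableOn.of_bound hφ.compact.isCompact.measure_lt_top
      hφ.measurable.aestronglyMeasurable C (Filter.Eventually.of_forall hC)
  exact ((integrableOn_iff_integrable_of_support_subset
    (subset_tsupport _)).1 h1).locallyIntegrable

lemma continuous_smul_shell {m : ℝ} (A : SL2C) : Continuous fun p : Shell m => A • p := by
  refine Continuous.subtype_mk ?_ _
  exact (LinearMap.continuous_of_finiteDimensional (lorentz A)).comp continuous_subtype_val

lemma measurable_littleGroup {m : ℝ} (L : StdTransf m) (Λ : SL2C) {F : littleGroup m → ℂ}
    (hF : Continuous F) : Measurable fun p => F (wigner L Λ p) := by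
  let _ : MeasurableSpace (littleGroup m) := borel _
  have _ : BorelSpace (littleGroup m) := ⟨rfl⟩
  refine hF.measurable.comp ?_
  let ι : littleGroup m → (Fin 2 → Fin 2 → ℂ) := fun W => W.1.1
  have hind : Topology.IsInducing ι :=
    Topology.IsInducing.subtypeVal.comp Topology.IsInducing.subtypeVal
  have hb : borel (littleGroup m) = MeasurableSpace.comap ι inferInstance := by
    rw [hind.eq_induced, borel_comap, ← BorelSpace.measurable_eq]
  change @Measurable _ _ _ (borel _) _
  rw [hb, measurable_comap_iff]
  have hL := L.measurable_entry
  have hL' : ∀ i j, Measurable fun p => (L.L (Λ • p)).1 i j := fun i j =>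
    (hL i j).comp (continuous_smul_shell Λ).measurable
  refine measurable_pi_lambda _ fun i => measurable_pi_lambda _ fun j => ?_
  have e : (fun p => ((wigner L Λ p).1.1 : Matrix (Fin 2) (Fin 2) ℂ) i j)
      = fun p => ∑ a, (∑ b, ((L.L (Λ • p)).1.adjugate i b) * Λ.1 b a) * (L.L p).1 a j := by
    funext p
    simp [wigner, Matrix.mul_apply, Matrix.SpecialLinearGroup.coe_inv]
  change Measurable (fun p => ((wigner L Λ p).1.1 : Matrix (Fin 2) (Fin 2) ℂ) i j)
  rw [e]
  refine Finset.measurable_sum _ fun a _ => (Finset.measurable_sum _ fun b _ =>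
    Measurable.mul_const ?_ _).mul (hL a j)
  fin_cases i <;> fin_cases b <;> simp [Matrix.adjugate_fin_two] <;>
    exact hL' _ _

section Particles

variable {m : ℝ} {κ : Type*} [DecidableEq κ] {B : κ → Type*} [∀ n, Fintype (B n)]
  [∀ n, DecidableEq (B n)]

lemma measurable_kernel (L : StdTransf m)
    (Dj : ∀ n, littleGroup m →ₜ* Matrix.unitaryGroup (B n) ℂ) (g : PoincareCover)
    (s t : Σ n, B n) : Measurable fun p => kernel L Dj g p s t := by
  simp only [kernel, Matrix.smul_apply, smul_eq_mul]
  have hc : Continuous fun p : Shell m => (g.right⁻¹ • p).1 0 :=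
    (continuous_apply 0).comp (continuous_subtype_val.comp (continuous_smul_shell _))
  refine Measurable.mul (Measurable.mul ?_ ?_) ?_
  · have h0 := continuous_coord (m := m) 0
    have h1 := continuous_coord (m := m) 1
    have h2 := continuous_coord (m := m) 2
    have h3 := continuous_coord (m := m) 3
    refine Continuous.measurable ?_
    refine Complex.continuous_exp.comp (continuous_const.mul (Complex.continuous_ofReal.comp ?_))
    exact (((h0.mul_const _).neg.add (h1.mul_const _)).add (h2.mul_const _)).add
      (h3.mul_const _)
  · exact Complex.measurable_ofReal.comp
      (Real.continuous_sqrt.measurable.comp (hc.measurable.div (continuous_coord 0).measurable))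
  · by_cases h : s.1 = t.1
    · obtain ⟨n, σ⟩ := s
      obtain ⟨n', τ⟩ := t
      obtain rfl : n = n' := h
      simp only [Matrix.blockDiagonal'_apply_eq]
      refine (measurable_littleGroup L g.right
        (F := fun W => (Dj n W : Matrix (B n) (B n) ℂ) σ τ) ?_).comp
        (continuous_smul_shell g.right⁻¹).measurable
      have h1 : Continuous fun W => (Dj n W : Matrix (B n) (B n) ℂ) :=
        continuous_subtype_val.comp (map_continuous (Dj n))
      exact h1.matrix_elem σ τ
    · simp only [Matrix.blockDiagonal'_apply, dif_neg h]
      exact measurable_const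

lemma norm_kernel_le (L : StdTransf m)
    (Dj : ∀ n, littleGroup m →ₜ* Matrix.unitaryGroup (B n) ℂ) (g : PoincareCover)
    (s t : Σ n, B n) (p : Shell m) :
    ‖kernel L Dj g p s t‖ ≤ Real.sqrt ((g.right⁻¹ • p).1 0 / p.1 0) := by
  have hb : ‖(Matrix.blockDiagonal' fun n =>
      (Dj n (wigner L g.right (g.right⁻¹ • p)) : Matrix (B n) (B n) ℂ)) s t‖ ≤ 1 := by
    rw [Matrix.blockDiagonal'_apply]
    split_ifs
    · exact entry_norm_bound_of_unitary (Subtype.prop _) _ _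
    · simp
  have he : ‖Complex.exp (-Complex.I * (mink p.1 (Multiplicative.toAdd g.left) : ℝ))‖ = 1 := by
    rw [Complex.norm_exp]; simp
  simp only [kernel, Matrix.smul_apply, smul_eq_mul, norm_mul, he, one_mul]
  refine (mul_le_of_le_one_right (norm_nonneg _) hb).trans ?_
  rw [Complex.norm_real, Real.norm_of_nonneg (Real.sqrt_nonneg _)]

lemma isPacket_kernel (L : StdTransf m)
    (Dj : ∀ n, littleGroup m →ₜ* Matrix.unitaryGroup (B n) ℂ) (g : PoincareCover)
    (s t : Σ n, B n) {f : Shell m → ℂ} (hf : IsPacket f) :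
    IsPacket fun p => kernel L Dj g p s t * f (g.right⁻¹ • p) := by
  obtain ⟨C, hC⟩ := hf.bounded
  have hcs : HasCompactSupport fun p : Shell m => f (g.right⁻¹ • p) := by
    let e : Shell m ≃ₜ Shell m :=
      { toEquiv := MulAction.toPerm g.right⁻¹
        continuous_toFun := continuous_smul_shell _
        continuous_invFun := continuous_smul_shell _ }
    exact hf.compact.comp_homeomorph e
  have hmeas : Measurable fun p : Shell m => f (g.right⁻¹ • p) :=
    hf.measurable.comp (continuous_smul_shell _).measurable
  refine ⟨(measurable_kernel L Dj g s t).mul hmeas, ?_, hcs.mul_left⟩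
  have hcont : Continuous fun p : Shell m => Real.sqrt ((g.right⁻¹ • p).1 0 / p.1 0) := by
    refine Real.continuous_sqrt.comp (Continuous.div ?_ (continuous_coord 0) fun p => p.2.1.ne')
    exact (continuous_apply 0).comp (continuous_subtype_val.comp (continuous_smul_shell _))
  obtain ⟨M, hM⟩ := hcs.isCompact.exists_bound_of_continuousOn hcont.continuousOn
  refine ⟨|M| * |C|, fun p => ?_⟩
  by_cases hp : p ∈ tsupport fun p : Shell m => f (g.right⁻¹ • p)
  · rw [norm_mul]
    refine mul_le_mul ?_ ((hC _).trans (le_abs_self C)) (norm_nonneg _) (abs_nonneg M)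
    exact (norm_kernel_le L Dj g s t p).trans
      ((le_abs_self _).trans ((hM p hp).trans (le_abs_self M)))
  · rw [image_eq_zero_of_notMem_tsupport hp]
    simp only [mul_zero, norm_zero]
    positivity

/-- The dense `U₀`-invariant space of one-particle wave packets (bounded measurable wave functions
with compact support on the mass shell). -/
def Packets (m : ℝ) (S : Type*) : Submodule ℂ (Shell m → S → ℂ) where
  carrier := {φ | ∀ s, IsPacket fun p => φ p s}
  add_mem' hφ hψ s := (hφ s).add (hψ s)
  zero_mem' _ := IsPacket.zero
  smul_mem' c _ hφ s := (hφ s).const_mul c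

variable [Fintype κ]

/-- The state representation `U₀` on wave packets. -/
def U₀Packets (L : StdTransf m) (Dj : ∀ n, littleGroup m →ₜ* Matrix.unitaryGroup (B n) ℂ) :
    Representation ℂ PoincareCover (Packets m (Σ n, B n)) where
  toFun g := (U₀ L Dj g).restrict (p := Packets m (Σ n, B n)) (q := Packets m (Σ n, B n))
    fun _ hφ s => IsPacket.sum _ fun t => isPacket_kernel L Dj g s t (hφ t)
  map_one' := by ext1 φ; apply Subtype.ext; simp
  map_mul' g h := by
    refine LinearMap.ext fun φ => Subtype.ext ?_
    change U₀ L Dj (g * h) φ.1 = U₀ L Dj g (U₀ L Dj h φ.1)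
    rw [map_mul, Module.End.mul_apply]

/-- The restriction of the state representation to `SL(2,ℂ)`. -/
def U₀SL (L : StdTransf m) (Dj : ∀ n, littleGroup m →ₜ* Matrix.unitaryGroup (B n) ℂ) :
    Representation ℂ SL2C (Packets m (Σ n, B n)) :=
  (U₀Packets L Dj).comp SemidirectProduct.inr

end Particles

/-! ### Linear maps determined by the coefficients -/

section Coefficients

variable {m : ℝ} {S : Type*} [Fintype S] {ℓ : Type*}

/-- The linear map determined by the matrix `{w_l(p,σ)}_{l;p,σ}`, i.e. by
`(basis vector with label (p,σ)) ↦ ∑_l w_l(p,σ) e_l`: it sends the superposition with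
coefficients `φ(p,σ)` to the vector with components `∑_σ ∫ d³p φ(p,σ) w_l(p,σ)`. -/
def coeffMap (w : ℓ → Shell m → S → ℂ)
    (hw : ∀ l s, LocallyIntegrable (fun p => w l p s) (d3p m)) :
    Packets m S →ₗ[ℂ] (ℓ → ℂ) where
  toFun φ l := ∑ s, ∫ p, φ.1 p s * w l p s ∂(d3p m)
  map_add' φ ψ := by
    funext l
    rw [Pi.add_apply, ← Finset.sum_add_distrib]
    refine Finset.sum_congr rfl fun s _ => ?_
    rw [← integral_add ((φ.2 s).integrable_mul (hw l s)) ((ψ.2 s).integrable_mul (hw l s))]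
    simp [add_mul]
  map_smul' c φ := by
    funext l
    simp only [Pi.smul_apply, RingHom.id_apply, smul_eq_mul, Finset.mul_sum,
      ← integral_const_mul]
    simp [mul_assoc]

/-- The linear functional `∑_σ ∫ d³p χ(p,σ) Ψ*_{p,σ}`, where `Ψ*_{p,σ}` is the dual basis: it
sends the state `φ` to `∑_σ ∫ d³p χ(p,σ) φ(p,σ)`. -/
def dualPacket : Packets m S →ₗ[ℂ] Module.Dual ℂ (Packets m S) where
  toFun χ :=
    { toFun := fun φ => ∑ s, ∫ p, χ.1 p s * φ.1 p s ∂(d3p m)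
      map_add' := fun φ ψ => by
        rw [← Finset.sum_add_distrib]
        refine Finset.sum_congr rfl fun s _ => ?_
        rw [← integral_add ((χ.2 s).integrable_mul (φ.2 s).locallyIntegrable)
          ((χ.2 s).integrable_mul (ψ.2 s).locallyIntegrable)]
        simp [mul_add]
      map_smul' := fun c φ => by
        simp only [RingHom.id_apply, smul_eq_mul, Finset.mul_sum, ← integral_const_mul]
        simp [mul_left_comm] }
  map_add' χ ψ := by
    refine LinearMap.ext fun φ => ?_
    simp only [LinearMap.coe_mk, AddHom.coe_mk, LinearMap.add_apply]
    rw [← Finset.sum_add_distrib]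
    refine Finset.sum_congr rfl fun s _ => ?_
    rw [← integral_add ((χ.2 s).integrable_mul (φ.2 s).locallyIntegrable)
      ((ψ.2 s).integrable_mul (φ.2 s).locallyIntegrable)]
    simp [add_mul]
  map_smul' c χ := by
    refine LinearMap.ext fun φ => ?_
    simp only [LinearMap.coe_mk, AddHom.coe_mk, LinearMap.smul_apply, RingHom.id_apply,
      smul_eq_mul, Finset.mul_sum, ← integral_const_mul]
    simp [mul_assoc]

/-- The map `dualPacket χ ↦ V χ`, defined on the functionals `∑_σ ∫ d³p χ(p,σ) Ψ*_{p,σ}` given by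
wave packets, is a homomorphism from the dual (contragredient) representation of `ρ` to `D`: the
dual action takes `dualPacket χ` to a functional of the same kind, and `V` intertwines. -/
def IsHomFromDual (ρ : Representation ℂ SL2C (Packets m S)) (D : Representation ℂ SL2C (ℓ → ℂ))
    (V : Packets m S →ₗ[ℂ] (ℓ → ℂ)) : Prop :=
  ∀ (Λ : SL2C) (χ : Packets m S), ∃ χ' : Packets m S,
    dualPacket χ' = ρ.dual Λ (dualPacket χ) ∧ V χ' = D Λ (V χ)

end Coefficients

/-! ### Fock space -/

/-- Bose or Fermi statistics. -/
inductive Statistics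
  | bose
  | fermi

/-- The sign `ν` of the statistics: `+1` for bosons and `-1` for fermions. -/
def Statistics.sgn : Statistics → ℤˣ
  | bose => 1
  | fermi => -1

/-- The factor that an `N`-particle wave function acquires under a permutation. -/
def Statistics.perm (ν : Statistics) {N : ℕ} (τ : Equiv.Perm (Fin N)) : ℤˣ :=
  match ν with
  | bose => 1
  | fermi => Equiv.Perm.sign τ

/-- Sequences `(Φ_N)_N` of `N`-particle wave functions `Φ_N(p₁,…,p_N; σ₁,…,σ_N)`. -/
abbrev FockFun (m : ℝ) (S : Type*) : Type _ :=
  ∀ N : ℕ, (Fin N → Shell m) → (Fin N → S) → ℂ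

/-- Equality almost everywhere of sequences of wave functions. -/
def FockFun.AEEq {m : ℝ} {S : Type*} (Φ Φ' : FockFun m S) : Prop :=
  ∀ (N : ℕ) (s : Fin N → S),
    ∀ᵐ P ∂(Measure.pi fun _ : Fin N => d3p m), Φ N P s = Φ' N P s

/-- The dense domain of the Fock space `𝓕_ν`: finite-particle vectors whose wave functions are
(anti)symmetric, measurable, bounded and compactly supported. -/
structure IsFockVector {m : ℝ} {S : Type*} (ν : Statistics) (Φ : FockFun m S) : Prop where
  symmetric : ∀ (N : ℕ) (τ : Equiv.Perm (Fin N)) (P : Fin N → Shell m) (s : Fin N → S),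
    Φ N (P ∘ τ) (s ∘ τ) = ((ν.perm τ : ℤ) : ℂ) * Φ N P s
  finite : ∃ N₀, ∀ N, N₀ < N → Φ N = 0
  measurable : ∀ N s, Measurable fun P => Φ N P s
  bounded : ∀ N s, ∃ C : ℝ, ∀ P, ‖Φ N P s‖ ≤ C
  compact : ∀ N s, HasCompactSupport fun P => Φ N P s

section Particles

variable {m : ℝ} {κ : Type*} [Fintype κ] [DecidableEq κ] {B : κ → Type*} [∀ n, Fintype (B n)]
  [∀ n, DecidableEq (B n)]

/-- The representation `U₀` of `ℝ^{1,3} ⋊ SL(2,ℂ)` on Fock space: the `N`-th tensor power of the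
single-particle representation on `N`-particle wave functions. -/
def U₀Fock (L : StdTransf m) (Dj : ∀ n, littleGroup m →ₜ* Matrix.unitaryGroup (B n) ℂ) :
    Representation ℂ PoincareCover (FockFun m (Σ n, B n)) where
  toFun g :=
    { toFun := fun Φ N P s =>
        ∑ t : Fin N → Σ n, B n, (∏ i, kernel L Dj g (P i) (s i) (t i)) *
          Φ N (fun i => g.right⁻¹ • P i) t
      map_add' := fun Φ Ψ => by funext N P s; simp [mul_add, Finset.sum_add_distrib]
      map_smul' := fun c Φ => by funext N P s; simp [Finset.mul_sum, mul_left_comm] }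
  map_one' := by
    refine LinearMap.ext fun Φ => ?_
    funext N P s
    simp only [LinearMap.coe_mk, AddHom.coe_mk, kernel_one, Module.End.one_apply,
      SemidirectProduct.one_right, inv_one, one_smul]
    rw [Finset.sum_eq_single s]
    · simp
    · intro t _ hts
      obtain ⟨i, hi⟩ := Function.ne_iff.1 hts
      have h0 : ∏ i, (1 : Matrix (Σ n, B n) (Σ n, B n) ℂ) (s i) (t i) = 0 :=
        Finset.prod_eq_zero (Finset.mem_univ i) (Matrix.one_apply_ne hi.symm)
      exact mul_eq_zero_of_left h0 _
    · simp
  map_mul' g h := by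
    refine LinearMap.ext fun Φ => ?_
    funext N P s
    simp only [LinearMap.coe_mk, AddHom.coe_mk, Module.End.mul_apply, kernel_mul,
      Matrix.mul_apply, Finset.prod_univ_sum, Fintype.piFinset_univ, Finset.mul_sum,
      Finset.sum_mul, Finset.prod_mul_distrib, SemidirectProduct.mul_right, _root_.mul_inv_rev,
      mul_smul]
    rw [Finset.sum_comm]
    simp only [mul_assoc]

end Particles

/-! ### Creation and annihilation operators, fields -/

section Fields

variable {m : ℝ} {S : Type*} {ℓ : Type*}

/-- `∑_σ ∫ d³p f(p,σ) a(p,σ)`, where the annihilation operator is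
`(a(p,σ) Φ)_N(q₁,…,q_N) = √(N+1) Φ_{N+1}((p,σ),q₁,…,q_N)`. -/
def annihilate [Fintype S] (f : Shell m → S → ℂ) (Φ : FockFun m S) : FockFun m S :=
  fun N P s => ∑ σ, ∫ p, f p σ *
    (Real.sqrt (N + 1) * Φ (N + 1) (Fin.cons p P) (Fin.cons σ s)) ∂(d3p m)

/-- `∑_σ ∫ d³p f(p,σ) a†(p,σ)`, where the creation operator is the formal adjoint
`(a†(p,σ) Φ)_{N+1}(q₀,…,q_N) = (N+1)^{-1/2} ∑_r ν^r δ(q_r - (p,σ)) Φ_N(q₀,…,q̂_r,…,q_N)` of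
`a(p,σ)`. -/
def create (ν : Statistics) (f : Shell m → S → ℂ) (Φ : FockFun m S) : FockFun m S
  | 0, _, _ => 0
  | N + 1, P, s => (Real.sqrt (N + 1) : ℂ)⁻¹ * ∑ r : Fin (N + 1),
      (((ν.sgn ^ (r : ℕ) : ℤˣ) : ℤ) : ℂ) * f (P r) (s r) *
        Φ N (fun i => P (r.succAbove i)) (fun i => s (r.succAbove i))

/-- The annihilation field
`ψ⁺_l(x) = (2π)^{-3/2} ∑_σ ∫ d³p u_l(p,σ) e^{i p·x} a(p,σ)`. -/
def annField [Fintype S] (u : ℓ → Shell m → S → ℂ) (l : ℓ) (x : R13) :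
    FockFun m S → FockFun m S :=
  annihilate fun p σ => (((2 * Real.pi) ^ (-(3 / 2) : ℝ) : ℝ) : ℂ) * u l p σ *
    Complex.exp (Complex.I * (mink p.1 x : ℝ))

/-- The creation field
`ψ⁻_l(x) = (2π)^{-3/2} ∑_σ ∫ d³p v_l(p,σ) e^{-i p·x} a†(p,σ)`. -/
def creField (ν : Statistics) (v : ℓ → Shell m → S → ℂ) (l : ℓ) (x : R13) :
    FockFun m S → FockFun m S :=
  create ν fun p σ => (((2 * Real.pi) ^ (-(3 / 2) : ℝ) : ℝ) : ℂ) * v l p σ *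
    Complex.exp (-Complex.I * (mink p.1 x : ℝ))

/-- A family of fields `ψ_l(x)` satisfies
`U₀(Λ,a)⁻¹ ψ_l(λ(Λ)x + a) U₀(Λ,a) = ∑_l' D_{ll'}(Λ) ψ_l'(x)` on the domain of Fock space,
for all `Λ ∈ SL(2,ℂ)` and all `a`, `x`. -/
def TransformsBy [Fintype ℓ] [DecidableEq ℓ] (ν : Statistics)
    (U : Representation ℂ PoincareCover (FockFun m S)) (D : Representation ℂ SL2C (ℓ → ℂ))
    (ψ : ℓ → R13 → FockFun m S → FockFun m S) : Prop :=
  ∀ (Λ : SL2C) (a x : R13) (l : ℓ) (Φ : FockFun m S), IsFockVector ν Φ →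
    FockFun.AEEq
      (U (poincare Λ a)⁻¹ (ψ l (lorentz Λ x + a) (U (poincare Λ a) Φ)))
      (∑ l', LinearMap.toMatrix' (D Λ) l l' • ψ l' x Φ)

end Fields

/-- The Lorentz transformation axiom for the annihilation and creation fields with coefficients
`u` and `v`, with respect to the state representation `U₀` and the field representation `D`. -/
def LorentzAxiom {m : ℝ} {κ : Type*} [Fintype κ] [DecidableEq κ] {B : κ → Type*}
    [∀ n, Fintype (B n)] [∀ n, DecidableEq (B n)] {ℓ : Type*} [Fintype ℓ] [DecidableEq ℓ]
    (L : StdTransf m) (Dj : ∀ n, littleGroup m →ₜ* Matrix.unitaryGroup (B n) ℂ)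
    (ν : Statistics) (D : Representation ℂ SL2C (ℓ → ℂ))
    (u v : ℓ → Shell m → (Σ n, B n) → ℂ) : Prop :=
  TransformsBy ν (U₀Fock L Dj) D (annField u) ∧ TransformsBy ν (U₀Fock L Dj) D (creField ν v)

end QField

end

namespace QField

/-! ### Lorentz invariance of the mass-shell measure -/

/-! Both equivalences reduce to one-particle statements. `U₀Fock` is a tensor power. An annihilation
field contracts one slot of a wave function with `u l`, a creation field fills one new slot with `v
l`, and on every spectator slot the factors of `U₀(Λ,a)` and its inverse cancel
(`U₀Fock_inv_annihilate`, `U₀Fock_inv_create`). In the remaining slot the plane wave at `λ(Λ)x + a`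
absorbs the translation phase of `U₀(Λ,a)` and becomes the plane wave at `x`, so that only `SL(2,ℂ)`
acts (`U₀Fock_inv_annField`, `U₀Fock_inv_creField`).

For `ψ⁺` what is left is the intertwining relation of `coeffMap u` on the wave packet cut out of `Φ`
by fixing the spectators; one-particle states yield every packet. For `ψ⁻` what is left is the
relation `U₀(Λ⁻¹) v_l = ∑ D_{ll'}(Λ) v_l'` almost everywhere; the vacuum already detects it.

It remains to recognise this relation as equivariance on the dual (`isHomFromDual_iff_ae`). Since
`d³p/p⁰` is Lorentz invariant, the transpose of `U₀(Λ⁻¹)` sends a packet `χ` to another packet,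
`dualAction Λ χ`. One substitution (`sum_integral_dualAction_mul`) shows both that this packet
represents the dual action and that contracting it with `v_l` amounts to contracting `χ` with
`U₀(Λ⁻¹) v_l`. As packets separate locally integrable functions up to null sets, equivariance is the
almost-everywhere relation.

The invariance of `d³p/p⁰` is proved in spatial coordinates: the Jacobian is a 3 × 3 minor of a 4 ×
4 matrix of determinant ±1, hence up to sign an entry of the inverse matrix. -/

lemma lorentz_inv_apply (Λ : SL2C) (x : R13) : lorentz Λ⁻¹ (lorentz Λ x) = x := by
  rw [← Module.End.mul_apply, ← map_mul]; simp

lemma mink_lorentz_inv (Λ : SL2C) (x y : R13) :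
    mink x (lorentz Λ⁻¹ y) = mink (lorentz Λ x) y := by
  rw [← mink_lorentz Λ⁻¹ (lorentz Λ x), lorentz_inv_apply]

/-- The matrix of the Lorentz transformation `λ(Λ)`. -/
noncomputable def lorentzMatrix (Λ : SL2C) : Matrix (Fin 4) (Fin 4) ℝ :=
  LinearMap.toMatrix' (lorentz Λ)

lemma lorentzMatrix_mulVec (Λ : SL2C) (x : R13) : lorentzMatrix Λ *ᵥ x = lorentz Λ x := by
  rw [lorentzMatrix, ← Matrix.toLin'_apply, Matrix.toLin'_toMatrix']

lemma lorentzMatrix_apply (Λ : SL2C) (i j : Fin 4) :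
    lorentzMatrix Λ i j = lorentz Λ (Pi.single j 1) i := by
  rw [← lorentzMatrix_mulVec]; simp

lemma lorentzMatrix_mul (Λ Λ' : SL2C) :
    lorentzMatrix (Λ * Λ') = lorentzMatrix Λ * lorentzMatrix Λ' := by
  simp only [lorentzMatrix, map_mul, ← LinearMap.toMatrix'_mul]

lemma lorentzMatrix_one : lorentzMatrix 1 = 1 := by
  simp [lorentzMatrix]

/-- The inverse of a Minkowski isometry is its adjoint for the Minkowski form. Only the zeroth
column of the inverse is needed, for the cofactor in `abs_det_spatialJacobian`. -/
lemma lorentzMatrix_inv_zero_zero (Λ : SL2C) : lorentzMatrix Λ⁻¹ 0 0 = lorentzMatrix Λ 0 0 := by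
  have h := mink_lorentz_inv Λ (Pi.single 0 1) (Pi.single 0 1)
  simp only [lorentzMatrix_apply]
  simpa [mink] using h

lemma lorentzMatrix_inv_succ_zero (Λ : SL2C) (j : Fin 3) :
    lorentzMatrix Λ⁻¹ j.succ 0 = -lorentzMatrix Λ 0 j.succ := by
  have h := mink_lorentz_inv Λ (Pi.single j.succ 1) (Pi.single 0 1)
  simp only [lorentzMatrix_apply]
  fin_cases j <;> simpa [mink, Pi.single_apply] using h

/-- Take determinants in `Mᵀ η M = η`, where `M = lorentzMatrix Λ`. The sign is irrelevant for a
change of variables, so connectedness of `SL(2,ℂ)` is not invoked. -/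
lemma abs_det_lorentzMatrix (Λ : SL2C) : |(lorentzMatrix Λ).det| = 1 := by
  let η : Matrix (Fin 4) (Fin 4) ℝ := Matrix.diagonal ![-1, 1, 1, 1]
  have hη : ∀ x y : R13, x ⬝ᵥ η *ᵥ y = mink x y := fun x y => by
    simp [η, mink, dotProduct, Matrix.mulVec_diagonal, Fin.sum_univ_succ]
    ring
  have h : (lorentzMatrix Λ)ᵀ * η * lorentzMatrix Λ = η := by
    refine Matrix.ext_of_mulVec_single fun j => ?_
    refine dotProduct_eq _ _ fun x => ?_
    rw [dotProduct_comm, dotProduct_comm _ x, hη, ← Matrix.mulVec_mulVec, ← Matrix.mulVec_mulVec,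
      Matrix.dotProduct_mulVec, Matrix.vecMul_transpose, hη, lorentzMatrix_mulVec,
      lorentzMatrix_mulVec, mink_lorentz]
  have hd := congrArg Matrix.det h
  have hη' : η.det = -1 := by simp [η, Matrix.det_diagonal, Fin.prod_univ_succ]
  rw [Matrix.det_mul, Matrix.det_mul, Matrix.det_transpose, hη'] at hd
  have : (lorentzMatrix Λ).det ^ 2 = 1 := by linarith
  rw [← sq_eq_sq₀ (abs_nonneg _) zero_le_one, sq_abs, this, one_pow]

/-- The Jacobian matrix of `λ(Λ)` in spatial coordinates, `w` being the velocity. -/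
noncomputable def spatialJacobian (Λ : SL2C) (w : Fin 3 → ℝ) : Matrix (Fin 3) (Fin 3) ℝ :=
  Matrix.of fun i j => lorentzMatrix Λ i.succ j.succ + lorentzMatrix Λ i.succ 0 * w j

/-- Jacobi's complementary minor identity. The last three columns of `N` are the vectors `(w j,
e_j)`, tangent to the shell when `w` is the velocity, so the Jacobian is the lower right block of `C
= lorentzMatrix Λ * N`. Its determinant is the `(0,0)` entry of the adjugate, that is, `det C = ±1`
times the `(0,0)` entry of `C⁻¹ = N' * lorentzMatrix Λ⁻¹`. -/
lemma abs_det_spatialJacobian (Λ : SL2C) (w : Fin 3 → ℝ) :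
    |(spatialJacobian Λ w).det|
      = |lorentzMatrix Λ 0 0 + ∑ j : Fin 3, lorentzMatrix Λ 0 j.succ * w j| := by
  let N : Matrix (Fin 4) (Fin 4) ℝ := !![1, w 0, w 1, w 2; 0, 1, 0, 0; 0, 0, 1, 0; 0, 0, 0, 1]
  let N' : Matrix (Fin 4) (Fin 4) ℝ :=
    !![1, -w 0, -w 1, -w 2; 0, 1, 0, 0; 0, 0, 1, 0; 0, 0, 0, 1]
  have hN : N.det = 1 := by
    simp [N, Matrix.det_succ_column_zero, Fin.sum_univ_succ]
  have hNN' : N * N' = 1 := by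
    ext i j
    fin_cases i <;> fin_cases j <;> simp [N, N', Matrix.mul_apply, Fin.sum_univ_succ]
  let C := lorentzMatrix Λ * N
  have hC : |C.det| = 1 := by
    simp only [C, Matrix.det_mul, hN, mul_one, abs_det_lorentzMatrix]
  have hinv : C * (N' * lorentzMatrix Λ⁻¹) = 1 := by
    simp only [C]
    rw [Matrix.mul_assoc, ← Matrix.mul_assoc N, hNN', Matrix.one_mul, ← lorentzMatrix_mul,
      mul_inv_cancel, lorentzMatrix_one]
  have hadj : C.adjugate = C.det • (N' * lorentzMatrix Λ⁻¹) := by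
    rw [← Matrix.mul_one C.adjugate, ← hinv, ← Matrix.mul_assoc, Matrix.adjugate_mul,
      Matrix.smul_mul, Matrix.one_mul]
  have hsub : C.submatrix (Fin.succAbove 0) (Fin.succAbove 0) = spatialJacobian Λ w := by
    ext i j
    simp only [C, N, Matrix.submatrix_apply, spatialJacobian, Matrix.of_apply, Matrix.mul_apply]
    fin_cases j <;> simp [Fin.sum_univ_succ] <;> ring
  have h := Matrix.adjugate_fin_succ_eq_det_submatrix C 0 0
  rw [hsub, hadj] at h
  simp only [Fin.val_zero, add_zero, pow_zero, one_mul, Matrix.smul_apply, smul_eq_mul] at h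
  rw [← h, abs_mul, hC, one_mul]
  congr 1
  have h1 := lorentzMatrix_inv_succ_zero Λ 0
  have h2 := lorentzMatrix_inv_succ_zero Λ 1
  have h3 := lorentzMatrix_inv_succ_zero Λ 2
  simp only [Fin.succ_zero_eq_one, Fin.succ_one_eq_two, show Fin.succ (2 : Fin 3) = 3 from rfl]
    at h1 h2 h3
  simp [N', Matrix.mul_apply, Fin.sum_univ_succ, lorentzMatrix_inv_zero_zero, h1, h2, h3,
    show Fin.succ (2 : Fin 3) = 3 from rfl]
  ring

/-- The energy `√(m² + 𝐩²)` of a particle of mass `m` and momentum `𝐩`. -/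
noncomputable def energy (m : ℝ) (q : Fin 3 → ℝ) : ℝ := Real.sqrt (m ^ 2 + ∑ i, q i ^ 2)

/-- The spatial coordinates of a point of the mass shell. -/
def spatial {m : ℝ} (p : Shell m) (i : Fin 3) : ℝ := p.1 i.succ

lemma energy_spatial {m : ℝ} (p : Shell m) : energy m (spatial p) = p.1 0 := by
  have h := p.2.2
  rw [energy, Real.sqrt_eq_iff_mul_self_eq_of_pos p.2.1]
  simp only [mink] at h
  simp [Fin.sum_univ_succ, spatial, show Fin.succ (2 : Fin 3) = 3 from rfl]
  linarith

/-- The action of `λ(Λ)` on the mass shell in spatial coordinates. -/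
noncomputable def spatialAction (m : ℝ) (Λ : SL2C) (q : Fin 3 → ℝ) (i : Fin 3) : ℝ :=
  lorentzMatrix Λ i.succ 0 * energy m q + ∑ j : Fin 3, lorentzMatrix Λ i.succ j.succ * q j

lemma spatialAction_spatial {m : ℝ} (Λ : SL2C) (p : Shell m) :
    spatialAction m Λ (spatial p) = spatial (Λ • p) := by
  funext i
  rw [spatialAction, energy_spatial, spatial, coe_smul, ← lorentzMatrix_mulVec, Matrix.mulVec,
    dotProduct, Fin.sum_univ_succ]
  rfl

lemma hasFDerivAt_spatialAction {m : ℝ} (Λ : SL2C) (p : Shell m) :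
    HasFDerivAt (spatialAction m Λ)
      (Matrix.toLin' (spatialJacobian Λ fun j => spatial p j / p.1 0)).toContinuousLinearMap
      (spatial p) := by
  have hE : HasFDerivAt (energy m)
      (∑ j : Fin 3, (spatial p j / p.1 0) •
        ContinuousLinearMap.proj (R := ℝ) (φ := fun _ : Fin 3 => ℝ) j) (spatial p) := by
    have h1 : HasFDerivAt (fun q : Fin 3 → ℝ => m ^ 2 + ∑ i, q i ^ 2)
        (∑ j : Fin 3, (2 * spatial p j) •
          ContinuousLinearMap.proj (R := ℝ) (φ := fun _ : Fin 3 => ℝ) j) (spatial p) := by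
      refine (HasFDerivAt.fun_sum fun i _ => ?_).const_add _
      have := ((ContinuousLinearMap.proj (R := ℝ) (φ := fun _ : Fin 3 => ℝ) i).hasFDerivAt
        (x := spatial p)).pow 2
      simpa using this
    have hp : energy m (spatial p) = p.1 0 := energy_spatial p
    -- The square root must be differentiated away from zero. For `m = 0` this excludes the tip of
    -- the cone, which the condition `p⁰ > 0` removes from the shell.
    have hne : m ^ 2 + ∑ i, spatial p i ^ 2 ≠ 0 := fun h => by
      rw [energy, h, Real.sqrt_zero] at hp
      exact p.2.1.ne hp
    have h2 := h1.sqrt hne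
    rw [show Real.sqrt (m ^ 2 + ∑ i, spatial p i ^ 2) = p.1 0 from hp] at h2
    refine h2.congr_fderiv ?_
    rw [Finset.smul_sum]
    refine Finset.sum_congr rfl fun j _ => ?_
    rw [smul_smul]
    congr 1
    have := p.2.1.ne'
    field_simp
  refine hasFDerivAt_pi'.2 fun i => ?_
  have h := (hE.const_mul (lorentzMatrix Λ i.succ 0)).add
    (HasFDerivAt.fun_sum fun (j : Fin 3) (_ : j ∈ Finset.univ) =>
      ((ContinuousLinearMap.proj (R := ℝ) (φ := fun _ : Fin 3 => ℝ) j).hasFDerivAt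
        (x := spatial p)).const_mul (lorentzMatrix Λ i.succ j.succ))
  refine h.congr_fderiv ?_
  ext x
  simp [spatialJacobian, Matrix.mulVec, dotProduct, Finset.mul_sum, add_mul,
    Finset.sum_add_distrib]
  rw [add_comm]
  simp [mul_assoc]

/-- The density of the image of `d³p` under `λ(Λ)⁻¹` with respect to `d³p`. -/
noncomputable def energyRatio {m : ℝ} (Λ : SL2C) (p : Shell m) : ℝ := (Λ • p).1 0 / p.1 0

lemma energyRatio_pos {m : ℝ} (Λ : SL2C) (p : Shell m) : 0 < energyRatio Λ p :=
  div_pos (Λ • p).2.1 p.2.1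

lemma continuous_energyRatio {m : ℝ} (Λ : SL2C) :
    Continuous fun p : Shell m => energyRatio Λ p :=
  ((continuous_coord 0).comp (continuous_smul_shell Λ)).div (continuous_coord 0)
    fun p => p.2.1.ne'

lemma abs_det_spatialJacobian_velocity {m : ℝ} (Λ : SL2C) (p : Shell m) :
    |(spatialJacobian Λ fun j => spatial p j / p.1 0).det| = energyRatio Λ p := by
  rw [abs_det_spatialJacobian, ← abs_of_pos (energyRatio_pos Λ p)]
  congr 1
  rw [energyRatio, coe_smul, ← lorentzMatrix_mulVec, Matrix.mulVec, dotProduct,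
    Fin.sum_univ_succ (n := 3), add_div, mul_div_cancel_right₀ _ p.2.1.ne', Finset.sum_div]
  simp [spatial, mul_div_assoc]

/-- This is the invariance of `d³p/p⁰`, from the change of variables formula in `ℝ³`: by
`abs_det_spatialJacobian_velocity` the Jacobian is the ratio of final to initial energy. -/
lemma d3p_image_smul {m : ℝ} (Λ : SL2C) {s : Set (Shell m)} (hs : MeasurableSet s) :
    d3p m ((fun p => Λ • p) '' s) = ∫⁻ p in s, ENNReal.ofReal (energyRatio Λ p) ∂(d3p m) := by
  have hemb : MeasurableEmbedding (spatial : Shell m → Fin 3 → ℝ) := measurableEmbedding_spatial m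
  have hcomap : d3p m = Measure.comap spatial volume := rfl
  -- The change of variables formula takes the derivative as a function on `ℝ³`, so the velocity is
  -- expressed through the spatial coordinates.
  let vel : (Fin 3 → ℝ) → Fin 3 → ℝ := fun q j => q j / energy m q
  have hvel : ∀ p : Shell m, vel (spatial p) = fun j => spatial p j / p.1 0 := fun p => by
    simp only [vel, energy_spatial]
  have himage : spatial '' ((fun p : Shell m => Λ • p) '' s)
      = spatialAction m Λ '' (spatial '' s) := by
    simp only [Set.image_image, spatialAction_spatial]
  have hinj : Set.InjOn (spatialAction m Λ) (spatial '' s) := by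
    rintro _ ⟨p, -, rfl⟩ _ ⟨p', -, rfl⟩ h
    rw [spatialAction_spatial, spatialAction_spatial] at h
    rw [MulAction.injective Λ (hemb.injective h)]
  rw [hcomap, hemb.comap_apply, himage,
    ← lintegral_abs_det_fderiv_eq_addHaar_image volume (hemb.measurableSet_image.2 hs)
      (f' := fun q => (Matrix.toLin' (spatialJacobian Λ (vel q))).toContinuousLinearMap) ?_ hinj]
  · let G : (Fin 3 → ℝ) → ENNReal := fun q => ENNReal.ofReal
      |((Matrix.toLin' (spatialJacobian Λ (vel q))).toContinuousLinearMap).det|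
    have hG : ∀ p : Shell m, ENNReal.ofReal (energyRatio Λ p) = G (spatial p) := fun p => by
      simp only [G, hvel, ContinuousLinearMap.det, LinearMap.coe_toContinuousLinearMap,
        LinearMap.det_toLin', abs_det_spatialJacobian_velocity]
    simp only [hG]
    rw [hemb.restrict_comap, ← hemb.lintegral_map, hemb.map_comap,
      Measure.restrict_restrict hemb.measurableSet_range,
      Set.inter_eq_right.2 (Set.image_subset_range _ _)]
  · rintro _ ⟨p, -, rfl⟩
    rw [hvel]
    exact (hasFDerivAt_spatialAction Λ p).hasFDerivWithinAt

lemma measurePreserving_smul {m : ℝ} (Λ : SL2C) :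
    MeasurePreserving (fun p : Shell m => Λ • p)
      ((d3p m).withDensity fun p => ENNReal.ofReal (energyRatio Λ p)) (d3p m) := by
  have hmeas : Measurable fun p : Shell m => Λ • p := (continuous_smul_shell Λ).measurable
  refine ⟨hmeas, Measure.ext fun s hs => ?_⟩
  rw [Measure.map_apply hmeas hs, withDensity_apply _ (hmeas hs), ← d3p_image_smul Λ (hmeas hs),
    Set.image_preimage_eq _ (MulAction.surjective Λ)]

/-- The action of `Λ` on the mass shell as a homeomorphism. -/
noncomputable def smulHomeomorph {m : ℝ} (Λ : SL2C) : Shell m ≃ₜ Shell m where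
  toEquiv := MulAction.toPerm Λ
  continuous_toFun := continuous_smul_shell _
  continuous_invFun := continuous_smul_shell _

lemma measurableEmbedding_smul {m : ℝ} (Λ : SL2C) :
    MeasurableEmbedding fun p : Shell m => Λ • p :=
  (smulHomeomorph Λ).measurableEmbedding

lemma integral_energyRatio_mul {m : ℝ} (Λ : SL2C) (f : Shell m → ℂ) :
    ∫ p, (energyRatio Λ p : ℂ) * f (Λ • p) ∂(d3p m) = ∫ p, f p ∂(d3p m) := by
  rw [← (measurePreserving_smul Λ).integral_comp (measurableEmbedding_smul Λ) f,
    integral_withDensity_eq_integral_toReal_smul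
      (continuous_energyRatio Λ).measurable.ennreal_ofReal (by simp)]
  simp [ENNReal.toReal_ofReal (energyRatio_pos Λ _).le]

lemma integrable_energyRatio_mul {m : ℝ} (Λ : SL2C) {f : Shell m → ℂ}
    (hf : Integrable f (d3p m)) :
    Integrable (fun p => (energyRatio Λ p : ℂ) * f (Λ • p)) (d3p m) := by
  rw [← (measurePreserving_smul Λ).integrable_comp_emb (measurableEmbedding_smul Λ),
    integrable_withDensity_iff_integrable_smul'
      (continuous_energyRatio Λ).measurable.ennreal_ofReal (by simp)] at hf
  simpa [ENNReal.toReal_ofReal (energyRatio_pos Λ _).le] using hf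

/-- The shell is an open condition intersected with a closed one; for `m = 0` it is not closed in
`ℝ⁴`, since the tip of the cone is missing. Local compactness lets local integrability be tested on
compact sets. -/
instance (m : ℝ) : LocallyCompactSpace (Shell m) := by
  refine IsLocallyClosed.locallyCompactSpace (s := {p : R13 | 0 < p 0 ∧ mink p p = -m ^ 2})
    (IsLocallyClosed.inter (IsOpen.isLocallyClosed ?_) (IsClosed.isLocallyClosed ?_))
  · exact isOpen_lt continuous_const (continuous_apply 0)
  · refine isClosed_eq ?_ continuous_const
    unfold mink
    fun_prop

/-! ### Wave packets as test functions -/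

lemma IsPacket.continuous_mul {m : ℝ} {f g : Shell m → ℂ} (hf : IsPacket f) (hg : Continuous g) :
    IsPacket fun p => g p * f p := by
  obtain ⟨C, hC⟩ := hf.bounded
  obtain ⟨M, hM⟩ := hf.compact.isCompact.exists_bound_of_continuousOn hg.continuousOn
  refine ⟨hg.measurable.mul hf.measurable, ⟨|M| * |C|, fun p => ?_⟩, hf.compact.mul_left⟩
  by_cases hp : p ∈ tsupport f
  · rw [norm_mul]
    exact mul_le_mul ((hM p hp).trans (le_abs_self M)) ((hC p).trans (le_abs_self C))
      (norm_nonneg _) (abs_nonneg M)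
  · rw [image_eq_zero_of_notMem_tsupport hp, mul_zero, norm_zero]
    positivity

lemma IsPacket.comp_smul {m : ℝ} {f : Shell m → ℂ} (hf : IsPacket f) (Λ : SL2C) :
    IsPacket fun p => f (Λ • p) := by
  obtain ⟨C, hC⟩ := hf.bounded
  exact ⟨hf.measurable.comp (continuous_smul_shell Λ).measurable, ⟨C, fun p => hC _⟩,
    hf.compact.comp_homeomorph (smulHomeomorph Λ)⟩

lemma isPacket_indicator {m : ℝ} {K : Set (Shell m)} (hK : IsCompact K) :
    IsPacket (K.indicator fun _ => (1 : ℂ)) := by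
  refine ⟨measurable_const.indicator hK.measurableSet, ⟨1, fun p => ?_⟩, ?_⟩
  · exact (norm_indicator_le_norm_self _ _).trans (by simp)
  · exact HasCompactSupport.intro hK fun p hp => Set.indicator_of_notMem hp _

/-- Indicators of compact sets are wave packets. -/
lemma locallyIntegrable_of_integrable_packet_mul {m : ℝ} {h : Shell m → ℂ}
    (hint : ∀ f : Shell m → ℂ, IsPacket f → Integrable (fun p => f p * h p) (d3p m)) :
    LocallyIntegrable h (d3p m) := by
  refine locallyIntegrable_iff.2 fun K hK => ?_
  rw [← integrable_indicator_iff hK.measurableSet]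
  refine (hint _ (isPacket_indicator hK)).congr (Filter.Eventually.of_forall fun p => ?_)
  by_cases hp : p ∈ K <;> simp [hp]

/-- A fundamental lemma of the calculus of variations: a locally integrable function is determined
almost everywhere by its integrals over compact sets, whose indicators are packets. -/
lemma ae_eq_zero_of_integral_packet_mul {m : ℝ} {h : Shell m → ℂ}
    (hint : LocallyIntegrable h (d3p m))
    (hzero : ∀ f : Shell m → ℂ, IsPacket f → ∫ p, f p * h p ∂(d3p m) = 0) :
    h =ᵐ[d3p m] 0 := by
  refine ae_eq_zero_of_forall_setIntegral_isCompact_eq_zero' hint fun K hK => ?_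
  rw [← hzero _ (isPacket_indicator hK), ← integral_indicator hK.measurableSet]
  refine integral_congr_ae (Filter.Eventually.of_forall fun p => ?_)
  by_cases hp : p ∈ K <;> simp [hp]

section Single

variable {m : ℝ} {S : Type*} [DecidableEq S]

/-- The wave packet with the single spin component `s`. -/
def singlePacket (s : S) {f : Shell m → ℂ} (hf : IsPacket f) : Packets m S :=
  ⟨fun p => Pi.single s (f p), fun s' => by
    by_cases h : s' = s
    · subst h; simpa using hf
    · simpa [h] using IsPacket.zero⟩

lemma sum_integral_singlePacket_mul [Fintype S] (s : S) {f : Shell m → ℂ} (hf : IsPacket f)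
    (w : Shell m → S → ℂ) :
    ∑ s', ∫ p, (singlePacket s hf).1 p s' * w p s' ∂(d3p m) = ∫ p, f p * w p s ∂(d3p m) := by
  rw [Finset.sum_eq_single s]
  · simp [singlePacket]
  · intro s' _ h
    simp [singlePacket, h]
  · simp

/-- Testing on packets with one spin component shows that a functional determines its representing
packet up to null sets. Hence the packet `χ'` in `IsHomFromDual` is essentially unique. -/
lemma ae_eq_of_dualPacket_eq [Fintype S] {χ χ' : Packets m S}
    (h : dualPacket χ = dualPacket χ') (s : S) :
    (fun p => χ.1 p s) =ᵐ[d3p m] fun p => χ'.1 p s := by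
  have h0 : (fun p => χ.1 p s - χ'.1 p s) =ᵐ[d3p m] 0 := by
    refine ae_eq_zero_of_integral_packet_mul
      ((χ.2 s).locallyIntegrable.sub (χ'.2 s).locallyIntegrable) fun f hf => ?_
    have e : ∀ ξ : Packets m S,
        dualPacket ξ (singlePacket s hf) = ∫ p, f p * ξ.1 p s ∂(d3p m) := fun ξ => by
      rw [← sum_integral_singlePacket_mul s hf ξ.1]
      simp only [dualPacket, LinearMap.coe_mk, AddHom.coe_mk, mul_comm]
    simp only [mul_sub]
    rw [integral_sub (hf.integrable_mul (χ.2 s).locallyIntegrable)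
      (hf.integrable_mul (χ'.2 s).locallyIntegrable), ← e, ← e, h, sub_self]
  filter_upwards [h0] with p hp using sub_eq_zero.1 hp

end Single

lemma coeffMap_congr_ae {m : ℝ} {S : Type*} [Fintype S] {ℓ : Type*} {w : ℓ → Shell m → S → ℂ}
    (hw : ∀ l s, LocallyIntegrable (fun p => w l p s) (d3p m)) {χ χ' : Packets m S}
    (h : ∀ s, (fun p => χ.1 p s) =ᵐ[d3p m] fun p => χ'.1 p s) :
    coeffMap w hw χ = coeffMap w hw χ' := by
  funext l
  refine Finset.sum_congr rfl fun s _ => integral_congr_ae ?_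
  filter_upwards [h s] with p hp
  rw [hp]

/-! ### The dual action on wave packets -/

section Particles

variable {m : ℝ} {κ : Type*} [DecidableEq κ] {B : κ → Type*} [∀ n, Fintype (B n)]
  [∀ n, DecidableEq (B n)]

lemma isPacket_dual_kernel (L : StdTransf m)
    (Dj : ∀ n, littleGroup m →ₜ* Matrix.unitaryGroup (B n) ℂ)
    (Λ : SL2C) {f : Shell m → ℂ} (hf : IsPacket f) (s t : Σ n, B n) :
    IsPacket fun q => ((energyRatio Λ (Λ⁻¹ • q) : ℂ))⁻¹ *
      (kernel L Dj (SemidirectProduct.inr Λ⁻¹) (Λ⁻¹ • q) s t * f (Λ⁻¹ • q)) := by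
  -- The kernel of `Λ⁻¹` multiplies functions evaluated at `Λ • p`; starting from `f ∘ Λ⁻¹` leaves
  -- `f p` itself.
  have h1 := isPacket_kernel L Dj (SemidirectProduct.inr Λ⁻¹) s t (hf.comp_smul Λ⁻¹)
  simp only [SemidirectProduct.right_inr, smul_inv_smul] at h1
  have hc : Continuous fun p : Shell m => (energyRatio Λ p : ℂ)⁻¹ :=
    (Complex.continuous_ofReal.comp (continuous_energyRatio Λ)).inv₀
      fun p => Complex.ofReal_ne_zero.2 (energyRatio_pos Λ p).ne'
  exact (h1.continuous_mul hc).comp_smul Λ⁻¹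

/-- Substitute `q = Λ • p`: the Jacobian `energyRatio Λ p` cancels its inverse. The first integrand
is a packet times the locally integrable `F`; integrability of the second is inherited through the
substitution, so `F` itself need not be a packet. -/
lemma kernel_change_of_variables (L : StdTransf m)
    (Dj : ∀ n, littleGroup m →ₜ* Matrix.unitaryGroup (B n) ℂ)
    (Λ : SL2C) {f F : Shell m → ℂ} (hf : IsPacket f) (hF : LocallyIntegrable F (d3p m))
    (s t : Σ n, B n) :
    Integrable (fun q => ((energyRatio Λ (Λ⁻¹ • q))⁻¹ : ℂ) *
      (kernel L Dj (SemidirectProduct.inr Λ⁻¹) (Λ⁻¹ • q) s t * f (Λ⁻¹ • q)) * F q) (d3p m) ∧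
    Integrable (fun p => f p *
      (kernel L Dj (SemidirectProduct.inr Λ⁻¹) p s t * F (Λ • p))) (d3p m) ∧
    ∫ q, ((energyRatio Λ (Λ⁻¹ • q))⁻¹ : ℂ) *
      (kernel L Dj (SemidirectProduct.inr Λ⁻¹) (Λ⁻¹ • q) s t * f (Λ⁻¹ • q)) * F q ∂(d3p m)
      = ∫ p, f p * (kernel L Dj (SemidirectProduct.inr Λ⁻¹) p s t * F (Λ • p)) ∂(d3p m) := by
  have hint := (isPacket_dual_kernel L Dj Λ hf s t).integrable_mul hF
  have e : ∀ p : Shell m, (energyRatio Λ p : ℂ) * (((energyRatio Λ (Λ⁻¹ • Λ • p))⁻¹ : ℂ) *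
      (kernel L Dj (SemidirectProduct.inr Λ⁻¹) (Λ⁻¹ • Λ • p) s t * f (Λ⁻¹ • Λ • p)) * F (Λ • p))
      = f p * (kernel L Dj (SemidirectProduct.inr Λ⁻¹) p s t * F (Λ • p)) := fun p => by
    have := (energyRatio_pos Λ p).ne'
    have : (energyRatio Λ p : ℂ) ≠ 0 := Complex.ofReal_ne_zero.2 this
    rw [inv_smul_smul]
    field_simp
  refine ⟨hint, ?_, ?_⟩
  · simpa only [e] using integrable_energyRatio_mul Λ hint
  · rw [← integral_energyRatio_mul Λ]
    simp only [e]

variable [Fintype κ]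

lemma U₀_apply (L : StdTransf m) (Dj : ∀ n, littleGroup m →ₜ* Matrix.unitaryGroup (B n) ℂ)
    (g : PoincareCover) (φ : Shell m → (Σ n, B n) → ℂ) (p : Shell m) (s : Σ n, B n) :
    U₀ L Dj g φ p s = ∑ t, kernel L Dj g p s t * φ (g.right⁻¹ • p) t := rfl

lemma coe_U₀SL (L : StdTransf m) (Dj : ∀ n, littleGroup m →ₜ* Matrix.unitaryGroup (B n) ℂ)
    (Λ : SL2C) (φ : Packets m (Σ n, B n)) :
    (U₀SL L Dj Λ φ).1 = U₀ L Dj (SemidirectProduct.inr Λ) φ.1 := rfl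

/-- The wave packet representing the dual action of `Λ` on the functional given by `χ`. -/
noncomputable def dualAction (L : StdTransf m)
    (Dj : ∀ n, littleGroup m →ₜ* Matrix.unitaryGroup (B n) ℂ)
    (Λ : SL2C) (χ : Packets m (Σ n, B n)) : Packets m (Σ n, B n) :=
  ⟨fun q t => ∑ s, ((energyRatio Λ (Λ⁻¹ • q))⁻¹ : ℂ) *
      (kernel L Dj (SemidirectProduct.inr Λ⁻¹) (Λ⁻¹ • q) s t * χ.1 (Λ⁻¹ • q) s), fun t =>
    IsPacket.sum _ fun s => isPacket_dual_kernel L Dj Λ (χ.2 s) s t⟩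

lemma integrable_mul_U₀ (L : StdTransf m)
    (Dj : ∀ n, littleGroup m →ₜ* Matrix.unitaryGroup (B n) ℂ)
    (Λ : SL2C) {f : Shell m → ℂ} (hf : IsPacket f) {F : Shell m → (Σ n, B n) → ℂ}
    (hF : ∀ s, LocallyIntegrable (fun p => F p s) (d3p m)) (s : Σ n, B n) :
    Integrable (fun p => f p * U₀ L Dj (SemidirectProduct.inr Λ⁻¹) F p s) (d3p m) := by
  simp only [U₀_apply, Finset.mul_sum, SemidirectProduct.right_inr, inv_inv]
  exact integrable_finsetSum _ fun t _ =>
    (kernel_change_of_variables L Dj Λ hf (hF t) s t).2.1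

/-- `dualAction Λ` is the transpose of `U₀(Λ⁻¹)`. The generality of `F` matters: it is a wave packet
in `dualPacket_dualAction` and a coefficient function `v l` in `isHomFromDual_iff_ae`. -/
lemma sum_integral_dualAction_mul (L : StdTransf m)
    (Dj : ∀ n, littleGroup m →ₜ* Matrix.unitaryGroup (B n) ℂ)
    (Λ : SL2C) (χ : Packets m (Σ n, B n)) {F : Shell m → (Σ n, B n) → ℂ}
    (hF : ∀ s, LocallyIntegrable (fun p => F p s) (d3p m)) :
    ∑ t, ∫ q, (dualAction L Dj Λ χ).1 q t * F q t ∂(d3p m)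
      = ∑ s, ∫ p, χ.1 p s * U₀ L Dj (SemidirectProduct.inr Λ⁻¹) F p s ∂(d3p m) := by
  have key := fun s t => kernel_change_of_variables L Dj Λ (χ.2 s) (hF t) s t
  simp only [U₀_apply, dualAction, Finset.mul_sum, Finset.sum_mul, SemidirectProduct.right_inr,
    inv_inv]
  rw [Finset.sum_congr rfl fun t _ => integral_finsetSum _ fun s _ => (key s t).1,
    Finset.sum_congr rfl fun s _ => integral_finsetSum _ fun t _ => (key s t).2.1,
    Finset.sum_comm]
  exact Finset.sum_congr rfl fun s _ => Finset.sum_congr rfl fun t _ => (key s t).2.2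

lemma dualPacket_dualAction (L : StdTransf m)
    (Dj : ∀ n, littleGroup m →ₜ* Matrix.unitaryGroup (B n) ℂ)
    (Λ : SL2C) (χ : Packets m (Σ n, B n)) :
    dualPacket (dualAction L Dj Λ χ) = (U₀SL L Dj).dual Λ (dualPacket χ) :=
  LinearMap.ext fun φ =>
    sum_integral_dualAction_mul L Dj Λ χ fun s => (φ.2 s).locallyIntegrable

variable {ℓ : Type*} [Fintype ℓ] [DecidableEq ℓ]

lemma representation_apply (D : Representation ℂ SL2C (ℓ → ℂ)) (Λ : SL2C) (y : ℓ → ℂ) (l : ℓ) :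
    D Λ y l = ∑ l', LinearMap.toMatrix' (D Λ) l l' * y l' := by
  conv_lhs => rw [← Matrix.toLin'_toMatrix' (D Λ), Matrix.toLin'_apply]
  rfl

/-- Both sides of the equivariance equation are pairings of `χ` with locally integrable functions,
namely with `U₀(Λ⁻¹) v_l` and with `∑ D_{ll'}(Λ) v_l'`. They agree for every `χ` exactly when these
functions agree almost everywhere. -/
lemma isHomFromDual_iff_ae (L : StdTransf m)
    (Dj : ∀ n, littleGroup m →ₜ* Matrix.unitaryGroup (B n) ℂ)
    (D : Representation ℂ SL2C (ℓ → ℂ)) (v : ℓ → Shell m → (Σ n, B n) → ℂ)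
    (hv : ∀ l s, LocallyIntegrable (fun p => v l p s) (d3p m)) :
    IsHomFromDual (U₀SL L Dj) D (coeffMap v hv) ↔
      ∀ (Λ : SL2C) (l : ℓ) (s : Σ n, B n), ∀ᵐ p ∂(d3p m),
        U₀ L Dj (SemidirectProduct.inr Λ⁻¹) (v l) p s
          = ∑ l', LinearMap.toMatrix' (D Λ) l l' * v l' p s := by
  have hV : ∀ Λ χ l, coeffMap v hv (dualAction L Dj Λ χ) l
      = ∑ s, ∫ p, χ.1 p s * U₀ L Dj (SemidirectProduct.inr Λ⁻¹) (v l) p s ∂(d3p m) :=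
    fun Λ χ l => sum_integral_dualAction_mul L Dj Λ χ (hv l)
  have hsum : ∀ Λ l s, LocallyIntegrable
      (fun p => ∑ l', LinearMap.toMatrix' (D Λ) l l' * v l' p s) (d3p m) := fun Λ l s => by
    refine locallyIntegrable_of_integrable_packet_mul fun f hf => ?_
    simp only [Finset.mul_sum, mul_left_comm (f _)]
    exact integrable_finsetSum _ fun l' _ => (hf.integrable_mul (hv l' s)).const_mul _
  have hD : ∀ Λ (χ : Packets m (Σ n, B n)) l, D Λ (coeffMap v hv χ) l
      = ∑ s, ∫ p, χ.1 p s * ∑ l', LinearMap.toMatrix' (D Λ) l l' * v l' p s ∂(d3p m) := by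
    intro Λ χ l
    rw [representation_apply]
    simp only [coeffMap, LinearMap.coe_mk, AddHom.coe_mk, Finset.mul_sum, mul_left_comm (χ.1 _ _)]
    rw [Finset.sum_comm]
    refine Finset.sum_congr rfl fun s _ => ?_
    rw [integral_finsetSum _ fun l' _ => ((χ.2 s).integrable_mul (hv l' s)).const_mul _]
    simp only [integral_const_mul]
  constructor
  · intro h Λ l s
    have hU : LocallyIntegrable (fun p => U₀ L Dj (SemidirectProduct.inr Λ⁻¹) (v l) p s)
        (d3p m) :=
      locallyIntegrable_of_integrable_packet_mul fun f hf => integrable_mul_U₀ L Dj Λ hf (hv l) s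
    have h0 := ae_eq_zero_of_integral_packet_mul (hU.sub (hsum Λ l s)) fun f hf => by
      obtain ⟨χ', h1, h2⟩ := h Λ (singlePacket s hf)
      -- The packet `χ'` supplied by the hypothesis represents the same functional as `dualAction`,
      -- so the two agree almost everywhere and have the same image under `coeffMap`.
      rw [← dualPacket_dualAction] at h1
      have h3 := congrFun ((coeffMap_congr_ae hv (ae_eq_of_dualPacket_eq h1)).symm.trans h2) l
      rw [hV, hD, sum_integral_singlePacket_mul s hf,
        sum_integral_singlePacket_mul s hf
          fun p s => ∑ l', LinearMap.toMatrix' (D Λ) l l' * v l' p s] at h3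
      simp only [Pi.sub_apply, mul_sub]
      rw [integral_sub (hf.integrable_mul hU) (hf.integrable_mul (hsum Λ l s)), h3, sub_self]
    filter_upwards [h0] with p hp using sub_eq_zero.1 hp
  · intro h Λ χ
    refine ⟨dualAction L Dj Λ χ, dualPacket_dualAction L Dj Λ χ, ?_⟩
    funext l
    rw [hV, hD]
    refine Finset.sum_congr rfl fun s _ => integral_congr_ae ?_
    filter_upwards [h Λ l s] with p hp
    rw [hp]

end Particles

/-! ### Translations and phases -/

lemma mink_add_right (p x y : R13) : mink p (x + y) = mink p x + mink p y := by
  simp only [mink, Pi.add_apply]; ring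

lemma mink_neg_right (p x : R13) : mink p (-x) = -mink p x := by
  simp only [mink, Pi.neg_apply]; ring

lemma continuous_exp_mink {m : ℝ} (c : ℂ) (x : R13) :
    Continuous fun p : Shell m => Complex.exp (c * (mink p.1 x : ℝ)) := by
  refine Complex.continuous_exp.comp (continuous_const.mul (Complex.continuous_ofReal.comp ?_))
  have h := fun i => continuous_coord (m := m) i
  exact ((((h 0).mul_const _).neg.add ((h 1).mul_const _)).add ((h 2).mul_const _)).add
    ((h 3).mul_const _)

lemma inv_poincare (Λ : SL2C) (a : R13) :
    (poincare Λ a)⁻¹ = poincare Λ⁻¹ (-lorentz Λ⁻¹ a) := by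
  refine SemidirectProduct.ext ?_ rfl
  change lorentzMulAut Λ⁻¹ (Multiplicative.ofAdd a)⁻¹ = _
  rw [map_inv]
  rfl

section Particles

variable {m : ℝ} {κ : Type*} [Fintype κ] [DecidableEq κ] {B : κ → Type*} [∀ n, Fintype (B n)]
  [∀ n, DecidableEq (B n)]

lemma U₀_poincare (L : StdTransf m) (Dj : ∀ n, littleGroup m →ₜ* Matrix.unitaryGroup (B n) ℂ)
    (Λ : SL2C) (a : R13) (φ : Shell m → (Σ n, B n) → ℂ) (p : Shell m) (s : Σ n, B n) :
    U₀ L Dj (poincare Λ a) φ p s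
      = Complex.exp (-Complex.I * (mink p.1 a : ℝ)) *
        U₀ L Dj (SemidirectProduct.inr Λ) φ p s := by
  have h0 : mink p.1 0 = 0 := by simp [mink]
  simp only [U₀_apply, Finset.mul_sum]
  refine Finset.sum_congr rfl fun t _ => ?_
  simp [kernel, poincare, h0]
  ring

lemma U₀_inr_mul (L : StdTransf m) (Dj : ∀ n, littleGroup m →ₜ* Matrix.unitaryGroup (B n) ℂ)
    (Λ : SL2C) (h : Shell m → ℂ) (φ : Shell m → (Σ n, B n) → ℂ) (p : Shell m) (s : Σ n, B n) :
    U₀ L Dj (SemidirectProduct.inr Λ) (fun p s => h p * φ p s) p s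
      = h (Λ⁻¹ • p) * U₀ L Dj (SemidirectProduct.inr Λ) φ p s := by
  simp only [U₀_apply, Finset.mul_sum, SemidirectProduct.right_inr, mul_left_comm]

/-! ### Annihilation fields -/

lemma U₀Fock_apply (L : StdTransf m) (Dj : ∀ n, littleGroup m →ₜ* Matrix.unitaryGroup (B n) ℂ)
    (g : PoincareCover) (Φ : FockFun m (Σ n, B n)) (N : ℕ) (P : Fin N → Shell m)
    (s : Fin N → Σ n, B n) :
    U₀Fock L Dj g Φ N P s = ∑ t : Fin N → Σ n, B n, (∏ i, kernel L Dj g (P i) (s i) (t i)) *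
      Φ N (fun i => g.right⁻¹ • P i) t := rfl

lemma U₀Fock_inv_apply (L : StdTransf m)
    (Dj : ∀ n, littleGroup m →ₜ* Matrix.unitaryGroup (B n) ℂ)
    (g : PoincareCover) (Φ : FockFun m (Σ n, B n)) (N : ℕ) (P : Fin N → Shell m)
    (s : Fin N → Σ n, B n) :
    U₀Fock L Dj g⁻¹ Φ N P s = ∑ t : Fin N → Σ n, B n, (∏ i, kernel L Dj g⁻¹ (P i) (s i) (t i)) *
      Φ N (fun i => g.right • P i) t := by
  rw [U₀Fock_apply, SemidirectProduct.inv_right, inv_inv]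

/-- The family of wave functions obtained by fixing the first particle. -/
def FockFun.slice {m : ℝ} {S : Type*} (Φ : FockFun m S) (p : Shell m) (σ : S) : FockFun m S :=
  fun N P s => Φ (N + 1) (Fin.cons p P) (Fin.cons σ s)

/-- The tensor power splits off its first factor: one kernel acts on the fixed particle and `U₀Fock`
on the rest. -/
lemma U₀Fock_slice (L : StdTransf m) (Dj : ∀ n, littleGroup m →ₜ* Matrix.unitaryGroup (B n) ℂ)
    (g : PoincareCover) (Φ : FockFun m (Σ n, B n)) (p : Shell m) (σ : Σ n, B n) :
    (U₀Fock L Dj g Φ).slice p σ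
      = ∑ τ, kernel L Dj g p σ τ • U₀Fock L Dj g (Φ.slice (g.right⁻¹ • p) τ) := by
  funext N P s
  have hP : (fun i => g.right⁻¹ • (Fin.cons p P : Fin (N + 1) → Shell m) i)
      = Fin.cons (g.right⁻¹ • p) fun i => g.right⁻¹ • P i := by
    funext i
    refine Fin.cases ?_ (fun i => ?_) i <;> simp
  simp only [Finset.sum_apply, Pi.smul_apply, smul_eq_mul]
  simp only [FockFun.slice, U₀Fock_apply, hP]
  rw [← (Fin.consEquiv (fun _ => Σ n, B n)).sum_comp, Fintype.sum_prod_type]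
  simp only [Fin.consEquiv_apply, Fin.prod_univ_succ, Fin.cons_zero, Fin.cons_succ, Finset.mul_sum, mul_assoc]
  rfl

lemma IsFockVector.isPacket_slice {m : ℝ} {S : Type*} {ν : Statistics} {Φ : FockFun m S}
    (hΦ : IsFockVector ν Φ) (σ : S) (N : ℕ) (P : Fin N → Shell m) (s : Fin N → S) :
    IsPacket fun p => Φ.slice p σ N P s := by
  have hcont : Continuous fun p : Shell m => (Fin.cons p P : Fin (N + 1) → Shell m) := by
    fun_prop
  obtain ⟨C, hC⟩ := hΦ.bounded (N + 1) (Fin.cons σ s)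
  refine ⟨(hΦ.measurable (N + 1) (Fin.cons σ s)).comp ?_, ⟨C, fun p => hC _⟩, ?_⟩
  · refine measurable_pi_lambda _ fun i => ?_
    refine Fin.cases ?_ (fun i => ?_) i
    · exact measurable_id
    · simp
  · have hK := (hΦ.compact (N + 1) (Fin.cons σ s)).isCompact.image (continuous_apply 0)
    refine HasCompactSupport.intro hK fun p hp => ?_
    by_contra h
    exact hp ⟨Fin.cons p P, subset_tsupport _ h, by simp⟩

lemma isPacket_U₀Fock_slice (L : StdTransf m)
    (Dj : ∀ n, littleGroup m →ₜ* Matrix.unitaryGroup (B n) ℂ) (g : PoincareCover)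
    {ν : Statistics} {Φ : FockFun m (Σ n, B n)} (hΦ : IsFockVector ν Φ) (σ : Σ n, B n) (N : ℕ)
    (P : Fin N → Shell m) (s : Fin N → Σ n, B n) :
    IsPacket fun p => (U₀Fock L Dj g Φ).slice p σ N P s := by
  simp only [U₀Fock_slice, Finset.sum_apply, Pi.smul_apply, smul_eq_mul]
  refine IsPacket.sum _ fun τ => ?_
  refine isPacket_kernel L Dj g σ τ
    (f := fun p => U₀Fock L Dj g (Φ.slice p τ) N P s) ?_
  simp only [U₀Fock_apply]
  exact IsPacket.sum _ fun t => (hΦ.isPacket_slice τ N _ t).const_mul _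

/-- The outer `U₀(g)⁻¹` undoes `U₀(g)` on the `N` particles that are not contracted (`hrec`).
Compact support of the slices and local integrability of `f` justify exchanging the spin sum with
the integral. -/
lemma U₀Fock_inv_annihilate (L : StdTransf m)
    (Dj : ∀ n, littleGroup m →ₜ* Matrix.unitaryGroup (B n) ℂ) (g : PoincareCover)
    {ν : Statistics} {Φ : FockFun m (Σ n, B n)} (hΦ : IsFockVector ν Φ)
    {f : Shell m → (Σ n, B n) → ℂ} (hf : ∀ s, LocallyIntegrable (fun p => f p s) (d3p m))
    (N : ℕ) (P : Fin N → Shell m) (s : Fin N → Σ n, B n) :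
    U₀Fock L Dj g⁻¹ (annihilate f (U₀Fock L Dj g Φ)) N P s
      = ∑ σ, ∫ p, f p σ * (Real.sqrt (N + 1) *
          U₀ L Dj g (fun p τ => Φ.slice p τ N P s) p σ) ∂(d3p m) := by
  have hint : ∀ t σ, Integrable (fun p => (∏ i, kernel L Dj g⁻¹ (P i) (s i) (t i)) *
      (f p σ * (Real.sqrt (N + 1) *
        (U₀Fock L Dj g Φ).slice p σ N (fun i => g.right • P i) t))) (d3p m) := fun t σ => by
    have h := (((isPacket_U₀Fock_slice L Dj g hΦ σ N (fun i => g.right • P i) t).const_mul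
      (Real.sqrt (N + 1))).integrable_mul (hf σ)).const_mul
        (∏ i, kernel L Dj g⁻¹ (P i) (s i) (t i))
    simpa only [mul_comm (f _ _)] using h
  have hrec : ∀ p σ, ∑ t : Fin N → Σ n, B n, (∏ i, kernel L Dj g⁻¹ (P i) (s i) (t i)) *
      (U₀Fock L Dj g Φ).slice p σ N (fun i => g.right • P i) t
      = U₀ L Dj g (fun p τ => Φ.slice p τ N P s) p σ := fun p σ => by
    rw [← U₀Fock_inv_apply, U₀Fock_slice, map_sum]
    simp only [map_smul, Finset.sum_apply, Pi.smul_apply, smul_eq_mul, U₀_apply]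
    refine Finset.sum_congr rfl fun τ _ => ?_
    rw [← Module.End.mul_apply, ← map_mul, inv_mul_cancel, map_one, Module.End.one_apply]
  rw [U₀Fock_inv_apply]
  change ∑ t : Fin N → Σ n, B n, (∏ i, kernel L Dj g⁻¹ (P i) (s i) (t i)) *
    ∑ σ, ∫ p, f p σ * (Real.sqrt (N + 1) *
      (U₀Fock L Dj g Φ).slice p σ N (fun i => g.right • P i) t) ∂(d3p m) = _
  simp only [Finset.mul_sum, ← integral_const_mul]
  rw [Finset.sum_comm]
  refine Finset.sum_congr rfl fun σ _ => ?_
  rw [← integral_finsetSum _ fun t _ => hint t σ]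
  refine integral_congr_ae (Filter.Eventually.of_forall fun p => ?_)
  simp only [← hrec, Finset.mul_sum]
  exact Finset.sum_congr rfl fun t _ => by ring

/-- The normalization `(2π)^{-3/2}` of the fields. -/
noncomputable def fieldNorm : ℂ := (((2 * Real.pi) ^ (-(3 / 2) : ℝ) : ℝ) : ℂ)

lemma fieldNorm_ne_zero : fieldNorm ≠ 0 :=
  Complex.ofReal_ne_zero.2 (Real.rpow_pos_of_pos Real.two_pi_pos _).ne'

/-- The one-particle wave packet `e^{i p·x} Φ_{N+1}((p,σ),(P,s))` that the annihilation field at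
`x` contracts with its coefficients. -/
noncomputable def IsFockVector.slicePacket {m : ℝ} {S : Type*} {ν : Statistics}
    {Φ : FockFun m S} (hΦ : IsFockVector ν Φ) (x : R13) (N : ℕ) (P : Fin N → Shell m)
    (s : Fin N → S) : Packets m S :=
  ⟨fun p σ => Complex.exp (Complex.I * (mink p.1 x : ℝ)) * Φ.slice p σ N P s,
    fun σ => (hΦ.isPacket_slice σ N P s).continuous_mul (continuous_exp_mink Complex.I x)⟩

variable {ℓ : Type*}

lemma annField_apply {m : ℝ} {S : Type*} [Fintype S] {u : ℓ → Shell m → S → ℂ}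
    (hu : ∀ l s, LocallyIntegrable (fun p => u l p s) (d3p m)) {ν : Statistics} {Φ : FockFun m S}
    (hΦ : IsFockVector ν Φ) (l : ℓ) (x : R13) (N : ℕ) (P : Fin N → Shell m) (s : Fin N → S) :
    annField u l x Φ N P s
      = fieldNorm * Real.sqrt (N + 1) * coeffMap u hu (hΦ.slicePacket x N P s) l := by
  simp only [annField, annihilate, coeffMap, LinearMap.coe_mk, AddHom.coe_mk, Finset.mul_sum,
    ← integral_const_mul, IsFockVector.slicePacket, fieldNorm, FockFun.slice]
  exact Finset.sum_congr rfl fun σ _ => integral_congr_ae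
    (Filter.Eventually.of_forall fun p => by ring)

lemma U₀Fock_inv_annField (L : StdTransf m)
    (Dj : ∀ n, littleGroup m →ₜ* Matrix.unitaryGroup (B n) ℂ)
    {u : ℓ → Shell m → (Σ n, B n) → ℂ}
    (hu : ∀ l s, LocallyIntegrable (fun p => u l p s) (d3p m)) {ν : Statistics}
    {Φ : FockFun m (Σ n, B n)} (hΦ : IsFockVector ν Φ) (Λ : SL2C) (a x : R13) (l : ℓ)
    (N : ℕ) (P : Fin N → Shell m) (s : Fin N → Σ n, B n) :
    U₀Fock L Dj (poincare Λ a)⁻¹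
        (annField u l (lorentz Λ x + a) (U₀Fock L Dj (poincare Λ a) Φ)) N P s
      = fieldNorm * Real.sqrt (N + 1) *
        coeffMap u hu (U₀SL L Dj Λ (hΦ.slicePacket x N P s)) l := by
  have hf : ∀ s, LocallyIntegrable (fun p => fieldNorm * u l p s *
      Complex.exp (Complex.I * (mink p.1 (lorentz Λ x + a) : ℝ))) (d3p m) := fun s => by
    refine locallyIntegrable_of_integrable_packet_mul fun f hf => ?_
    have h := ((hf.continuous_mul (continuous_exp_mink Complex.I
      (lorentz Λ x + a))).const_mul fieldNorm).integrable_mul (hu l s)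
    refine h.congr (Filter.Eventually.of_forall fun p => ?_)
    ring
  change U₀Fock L Dj (poincare Λ a)⁻¹ (annihilate (fun p σ => fieldNorm * u l p σ *
    Complex.exp (Complex.I * (mink p.1 (lorentz Λ x + a) : ℝ)))
      (U₀Fock L Dj (poincare Λ a) Φ)) N P s = _
  rw [U₀Fock_inv_annihilate L Dj _ hΦ hf]
  simp only [coeffMap, LinearMap.coe_mk, AddHom.coe_mk, Finset.mul_sum, ← integral_const_mul]
  refine Finset.sum_congr rfl fun σ _ => integral_congr_ae
    (Filter.Eventually.of_forall fun p => ?_)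
  simp only [coe_U₀SL, IsFockVector.slicePacket]
  -- Invariance of the product turns `e^{ip·λ(Λ)x}` into the plane wave at `x` evaluated at the
  -- initial momentum, where it passes inside `U₀(Λ)`. The other factor `e^{ip·a}` cancels the
  -- translation phase.
  have hk : mink (Λ⁻¹ • p).1 x = mink p.1 (lorentz Λ x) := by
    rw [← mink_lorentz Λ, ← coe_smul, smul_inv_smul]
  rw [U₀_poincare, U₀_inr_mul, hk,
    mink_add_right, Complex.ofReal_add, mul_add, Complex.exp_add, neg_mul, Complex.exp_neg]
  have := Complex.exp_ne_zero (Complex.I * (mink p.1 a : ℝ))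
  field_simp

/-- The sequence of wave functions of a one-particle state. -/
def oneParticle {m : ℝ} {S : Type*} (φ : Packets m S) : FockFun m S
  | 1, P, s => φ.1 (P 0) (s 0)
  | _, _, _ => 0

lemma Statistics.perm_one (ν : Statistics) {N : ℕ} :
    ν.perm (1 : Equiv.Perm (Fin N)) = 1 := by
  cases ν <;> simp [Statistics.perm]

lemma isFockVector_oneParticle {m : ℝ} {S : Type*} (ν : Statistics) (φ : Packets m S) :
    IsFockVector ν (oneParticle φ) where
  symmetric
    | 0, τ, P, s => by simp [oneParticle]
    | 1, τ, P, s => by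
      rw [Subsingleton.elim τ 1, Statistics.perm_one]
      simp
    | N + 2, τ, P, s => by simp [oneParticle]
  finite := ⟨1, fun N hN => by
    match N, hN with
    | N + 2, _ => rfl⟩
  measurable
    | 0, s => measurable_const
    | 1, s => (φ.2 (s 0)).measurable.comp (measurable_pi_apply 0)
    | N + 2, s => measurable_const
  bounded
    | 0, s => ⟨0, fun P => by simp [oneParticle]⟩
    | 1, s => (φ.2 (s 0)).bounded.imp fun C hC P => hC _
    | N + 2, s => ⟨0, fun P => by simp [oneParticle]⟩
  compact
    | 0, s => HasCompactSupport.zero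
    | 1, s => (φ.2 (s 0)).compact.comp_homeomorph (Homeomorph.funUnique (Fin 1) (Shell m))
    | N + 2, s => HasCompactSupport.zero

lemma slicePacket_oneParticle {m : ℝ} {S : Type*} (ν : Statistics) (φ : Packets m S)
    (P : Fin 0 → Shell m) (s : Fin 0 → S) :
    (isFockVector_oneParticle ν φ).slicePacket 0 0 P s = φ := by
  refine Subtype.ext ?_
  funext p σ
  simp [IsFockVector.slicePacket, FockFun.slice, oneParticle, mink]

/-- Each component of either side is a common scalar times a one-particle expression in the packet
`slicePacket`, so intertwining gives the axiom at every point. Conversely, the vacuum component on a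
one-particle state, at `x = 0`, recovers an arbitrary packet. -/
lemma annField_transformsBy_iff [Fintype ℓ] [DecidableEq ℓ] (L : StdTransf m)
    (Dj : ∀ n, littleGroup m →ₜ* Matrix.unitaryGroup (B n) ℂ) (ν : Statistics)
    (D : Representation ℂ SL2C (ℓ → ℂ)) {u : ℓ → Shell m → (Σ n, B n) → ℂ}
    (hu : ∀ l s, LocallyIntegrable (fun p => u l p s) (d3p m)) :
    TransformsBy ν (U₀Fock L Dj) D (annField u) ↔
      Representation.IsIntertwiningMap (U₀SL L Dj) D (coeffMap u hu) := by
  have hR : ∀ (Λ : SL2C) (x : R13) (l : ℓ) (Φ : FockFun m (Σ n, B n)) (hΦ : IsFockVector ν Φ)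
      (N : ℕ) (P : Fin N → Shell m) (s : Fin N → Σ n, B n),
      (∑ l', LinearMap.toMatrix' (D Λ) l l' • annField u l' x Φ) N P s
        = fieldNorm * Real.sqrt (N + 1) * D Λ (coeffMap u hu (hΦ.slicePacket x N P s)) l := by
    intro Λ x l Φ hΦ N P s
    rw [representation_apply]
    simp only [Finset.sum_apply, Pi.smul_apply, smul_eq_mul, annField_apply hu hΦ, Finset.mul_sum]
    exact Finset.sum_congr rfl fun l' _ => by ring
  constructor
  · intro h
    refine ⟨fun Λ φ => ?_⟩
    funext l
    have h0 := h Λ 0 0 l _ (isFockVector_oneParticle ν φ) 0 Fin.elim0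
    -- With no particles left the measure is a point mass, so an almost everywhere statement holds
    -- at an actual point.
    rw [Measure.pi_of_empty] at h0
    obtain ⟨P, hP⟩ := h0.exists
    rw [U₀Fock_inv_annField L Dj hu (isFockVector_oneParticle ν φ),
      hR Λ 0 l _ (isFockVector_oneParticle ν φ), slicePacket_oneParticle] at hP
    exact mul_left_cancel₀ (by simpa using fieldNorm_ne_zero) hP
  · intro h Λ a x l Φ hΦ N s
    refine Filter.Eventually.of_forall fun P => ?_
    rw [U₀Fock_inv_annField L Dj hu hΦ, hR Λ x l Φ hΦ, h.isIntertwining]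

/-! ### Creation fields -/

/-- Each term of `create` is a product of `f` in slot `r` and `Φ` in the others, and the tensor
power acts factor by factor. No integral occurs, so neither `f` nor `Φ` needs any regularity. -/
lemma U₀Fock_inv_create (L : StdTransf m)
    (Dj : ∀ n, littleGroup m →ₜ* Matrix.unitaryGroup (B n) ℂ) (g : PoincareCover)
    (ν : Statistics) (f : Shell m → (Σ n, B n) → ℂ) (Φ : FockFun m (Σ n, B n)) :
    U₀Fock L Dj g⁻¹ (create ν f (U₀Fock L Dj g Φ)) = create ν (U₀ L Dj g⁻¹ f) Φ := by
  funext N P s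
  cases N with
  | zero => simp [U₀Fock_apply, create]
  | succ N =>
    have hΦ : ∀ (P : Fin N → Shell m) (s : Fin N → Σ n, B n), Φ N P s
        = ∑ t : Fin N → Σ n, B n, (∏ i, kernel L Dj g⁻¹ (P i) (s i) (t i)) *
          U₀Fock L Dj g Φ N (fun i => g.right • P i) t := fun P s => by
      rw [← U₀Fock_inv_apply, ← Module.End.mul_apply, ← map_mul, inv_mul_cancel, map_one,
        Module.End.one_apply]
    rw [U₀Fock_inv_apply]
    simp only [create, Finset.mul_sum]
    rw [Finset.sum_comm]
    refine Finset.sum_congr rfl fun r _ => ?_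
    -- The sum over spin labels is split into the label of the created particle, in slot `r`, and
    -- those of the spectators.
    rw [hΦ, ← (Fin.insertNthEquiv (fun _ => Σ n, B n) r).sum_comp, Fintype.sum_prod_type,
      U₀_apply]
    simp only [Finset.mul_sum, Finset.sum_mul, Fin.insertNthEquiv_apply, Fin.prod_univ_succAbove _ r,
      Fin.insertNth_apply_same, Fin.insertNth_apply_succAbove, SemidirectProduct.inv_right,
      inv_inv]
    rw [Finset.sum_comm]
    refine Finset.sum_congr rfl fun t _ => Finset.sum_congr rfl fun τ _ => ?_
    ring

lemma U₀Fock_inv_creField (L : StdTransf m)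
    (Dj : ∀ n, littleGroup m →ₜ* Matrix.unitaryGroup (B n) ℂ) (ν : Statistics)
    (v : ℓ → Shell m → (Σ n, B n) → ℂ) (Φ : FockFun m (Σ n, B n)) (Λ : SL2C) (a x : R13) (l : ℓ) :
    U₀Fock L Dj (poincare Λ a)⁻¹
        (creField ν v l (lorentz Λ x + a) (U₀Fock L Dj (poincare Λ a) Φ))
      = creField ν (fun l => U₀ L Dj (SemidirectProduct.inr Λ⁻¹) (v l)) l x Φ := by
  rw [creField, U₀Fock_inv_create, creField]
  congr 1
  funext p s
  have h : (fun (p : Shell m) (σ : Σ n, B n) =>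
      (((2 * Real.pi) ^ (-(3 / 2) : ℝ) : ℝ) : ℂ) * v l p σ *
        Complex.exp (-Complex.I * (mink p.1 (lorentz Λ x + a) : ℝ)))
      = fun p σ => ((((2 * Real.pi) ^ (-(3 / 2) : ℝ) : ℝ) : ℂ) *
        Complex.exp (-Complex.I * (mink p.1 (lorentz Λ x + a) : ℝ))) * v l p σ := by
    funext p σ
    ring
  -- The translation part of `(Λ,a)⁻¹` is `-λ(Λ⁻¹)a`, with phase `e^{i(λ(Λ)p)·a}`. It cancels the
  -- factor `e^{-i(λ(Λ)p)·a}` of the plane wave transported to `λ(Λ)p`.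
  rw [h, inv_poincare, U₀_poincare, U₀_inr_mul, inv_inv, coe_smul, mink_add_right, mink_lorentz,
    mink_neg_right, mink_lorentz_inv, Complex.ofReal_add, mul_add, Complex.exp_add,
    Complex.ofReal_neg, mul_neg, Complex.exp_neg (-Complex.I * (mink (lorentz Λ p.1) a : ℝ))]
  have := Complex.exp_ne_zero (-Complex.I * (mink (lorentz Λ p.1) a : ℝ))
  field_simp

/-- The vacuum. -/
def vacuum (m : ℝ) (S : Type*) : FockFun m S
  | 0, _, _ => 1
  | _ + 1, _, _ => 0

lemma isFockVector_vacuum (m : ℝ) (S : Type*) (ν : Statistics) :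
    IsFockVector ν (vacuum m S) where
  symmetric
    | 0, τ, P, s => by
      rw [Subsingleton.elim τ 1, Statistics.perm_one]
      simp [vacuum]
    | N + 1, τ, P, s => by simp [vacuum]
  finite := ⟨0, fun N hN => by
    match N, hN with
    | N + 1, _ => rfl⟩
  measurable
    | 0, s => measurable_const
    | N + 1, s => measurable_const
  bounded
    | 0, s => ⟨1, fun P => by simp [vacuum]⟩
    | N + 1, s => ⟨0, fun P => by simp [vacuum]⟩
  compact
    | 0, s => HasCompactSupport.of_compactSpace _
    | N + 1, s => HasCompactSupport.zero

/-- The creation field is linear in its coefficients and uses only their values at the momenta `P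
r`, so an almost everywhere relation between coefficients passes to the fields. Conversely, on the
vacuum at `x = 0` the one-particle component of the field is `v l` up to normalization. -/
lemma creField_transformsBy_iff [Fintype ℓ] [DecidableEq ℓ] (L : StdTransf m)
    (Dj : ∀ n, littleGroup m →ₜ* Matrix.unitaryGroup (B n) ℂ) (ν : Statistics)
    (D : Representation ℂ SL2C (ℓ → ℂ)) (v : ℓ → Shell m → (Σ n, B n) → ℂ) :
    TransformsBy ν (U₀Fock L Dj) D (creField ν v) ↔
      ∀ (Λ : SL2C) (l : ℓ) (s : Σ n, B n), ∀ᵐ p ∂(d3p m),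
        U₀ L Dj (SemidirectProduct.inr Λ⁻¹) (v l) p s
          = ∑ l', LinearMap.toMatrix' (D Λ) l l' * v l' p s := by
  constructor
  · intro h Λ l s
    have h0 := h Λ 0 0 l _ (isFockVector_vacuum m _ ν) 1 fun _ => s
    rw [U₀Fock_inv_creField] at h0
    have hc : ∀ (w : ℓ → Shell m → (Σ n, B n) → ℂ) (l : ℓ) (P : Fin 1 → Shell m),
        creField ν w l 0 (vacuum m _) 1 P (fun _ => s) = fieldNorm * w l (P 0) s :=
      fun w l P => by simp [creField, create, vacuum, mink, fieldNorm]
    simp only [Finset.sum_apply, Pi.smul_apply, smul_eq_mul, hc] at h0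
    -- Null sets of one-particle configurations `Fin 1 → Shell m` are identified with null sets of
    -- the shell.
    have hmp := measurePreserving_funUnique (d3p m) (Fin 1)
    rw [← hmp.map_eq, (MeasurableEquiv.funUnique (Fin 1) (Shell m)).measurableEmbedding.ae_map_iff]
    filter_upwards [h0] with P hP
    refine mul_left_cancel₀ fieldNorm_ne_zero (hP.trans ?_)
    rw [Finset.mul_sum]
    exact Finset.sum_congr rfl fun l' _ => mul_left_comm _ _ _
  · intro h Λ a x l Φ _ N s
    rw [U₀Fock_inv_creField]
    -- Coordinate projections pull null sets back to null sets, so the one-particle relation holds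
    -- in all slots at once for almost every configuration.
    have hae : ∀ᵐ P ∂(Measure.pi fun _ : Fin N => d3p m), ∀ r,
        U₀ L Dj (SemidirectProduct.inr Λ⁻¹) (v l) (P r) (s r)
          = ∑ l', LinearMap.toMatrix' (D Λ) l l' * v l' (P r) (s r) :=
      ae_all_iff.2 fun r =>
        (Measure.quasiMeasurePreserving_eval (fun _ : Fin N => d3p m) r).ae (h Λ l (s r))
    filter_upwards [hae] with P hP
    simp only [Finset.sum_apply, Pi.smul_apply, smul_eq_mul]
    cases N with
    | zero => simp [creField, create]
    | succ N =>
      simp only [creField, create, hP, Finset.mul_sum, Finset.sum_mul]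
      rw [Finset.sum_comm]
      exact Finset.sum_congr rfl fun l' _ => Finset.sum_congr rfl fun r _ => by ring

end Particles

end QField

theorem mainTheorem8 {m : ℝ} (hm : 0 ≤ m)
    {κ : Type*} [Fintype κ] [DecidableEq κ]
    {B : κ → Type*} [∀ n, Fintype (B n)] [∀ n, DecidableEq (B n)]
    (L : QField.StdTransf m)
    (Dj : ∀ n, QField.littleGroup m →ₜ* Matrix.unitaryGroup (B n) ℂ)
    (ν : QField.Statistics)
    {ℓ : Type*} [Fintype ℓ] [DecidableEq ℓ]
    (D : Representation ℂ QField.SL2C (ℓ → ℂ))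
    (u v : ℓ → QField.Shell m → (Σ n, B n) → ℂ)
    (hu : ∀ l s, MeasureTheory.LocallyIntegrable (fun p => u l p s) (QField.d3p m))
    (hv : ∀ l s, MeasureTheory.LocallyIntegrable (fun p => v l p s) (QField.d3p m)) :
    QField.LorentzAxiom L Dj ν D u v ↔
      Representation.IsIntertwiningMap (QField.U₀SL L Dj) D (QField.coeffMap u hu) ∧
      QField.IsHomFromDual (QField.U₀SL L Dj) D (QField.coeffMap v hv) := by
  exact and_congr (QField.annField_transformsBy_iff L Dj ν D hu)
    ((QField.creField_transformsBy_iff L Dj ν D v).trans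
      (QField.isHomFromDual_iff_ae L Dj D v hv).symm)
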